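/- **Setting.** Let $\beta,\gamma\ge 0$ with $\beta\gamma>1$. For a finite simple graph $G=(V,E)$ and a field $\pi:V\to(0,\infty)$ let $$Z_{\beta,\gamma,\pi}(G)=\sum_{\sigma:V\to\{0,1\}}\beta^{m_0(\sigma)}\gamma^{m_1(\sigma)}\prod_{v:\,\sigma(v)=0}\pi(v),$$ where $m_i(\sigma)$ is the number of edges both of whose endpoints have spin $i$. Put $\Delta_c=\frac{\sqrt{\beta\gamma}+1}{\sqrt{\beta\gamma}-1}$. **Theorem 3.1.** Let $\Delta\ge 2$ be an integer with $\Delta<\Delta_c+1$, and let $\alpha=\frac{\Delta-1}{\Delta_c}$. There are a deterministic algorithm and a constant $C$, both depending only on $\beta,\gamma,\Delta$, with the following property. For every $n\ge 1$, every graph $G$ with $n$ vertices and maximum degree at most $\Delta$, every field $\pi:V\to(0,\infty)$ and every $\varepsilon>0$, the algorithm, given $\beta,\gamma,\varepsilon,\pi$ and a list of the edges of $G$, outputs a number $\hat Z$ with $$|\hat Z-Z_{\beta,\gamma,\pi}(G)|\le\varepsilon\, Z_{\beta,\gamma,\pi}(G)$$ in time at most $$C\,n\left(\max\left\{1,\frac{n\lambda}{\varepsilon}\right\}\right)^{\frac{\log(\Delta-1)}{-\log\alpha}},\qquad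 \lambda=\max_{v\in V}\pi(v).$$ (So the time is $O\big(n(n\lambda/\varepsilon)^{\log(\Delta-1)/(-\log\alpha)}\big)$ whenever $n\lambda\ge\varepsilon$; and for $\varepsilon\le 1$ and fixed $\lambda$ it always is, with a constant that may depend on $\lambda$.) Time is the number of steps of a real random access machine, that is, one with unit-cost field operations and comparisons of real numbers, unit-cost addition, subtraction and comparison of natural numbers used as addresses, and integer program constants only. -/

import Mathlib

namespace TwoSpin

/-- Weight of a configuration: every `(0,0)` edge contributes `β`, every `(1,1)` edge contributes
`γ`, and every vertex `v` of spin `0` contributes its external field `π v`. -/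
noncomputable def weight {V : Type*} [Fintype V] (G : SimpleGraph V) (β γ : ℝ) (π : V → ℝ)
    (σ : V → Fin 2) : ℝ :=
  β ^ {e ∈ G.edgeSet | ∀ v ∈ e, σ v = 0}.ncard * γ ^ {e ∈ G.edgeSet | ∀ v ∈ e, σ v = 1}.ncard *
    ∏ v with σ v = 0, π v

/-- The partition function `Z_{β,γ,π}(G)`. -/
noncomputable def partitionFunction {V : Type*} [Fintype V] [DecidableEq V] (G : SimpleGraph V)
    (β γ : ℝ) (π : V → ℝ) : ℝ :=
  ∑ σ : V → Fin 2, weight G β γ π σ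

/-- The critical degree `Δ_c`. -/
noncomputable def criticalDegree (β γ : ℝ) : ℝ :=
  (√(β * γ) + 1) / (√(β * γ) - 1)

end TwoSpin

/-! A deterministic real random access machine. The memory consists of arrays of natural numbers
(used for addresses and counters) and arrays of real numbers. The name of an array is a fixed part
of the program; cells are addressed by computed natural numbers. The only arithmetic on natural
numbers is addition and truncated subtraction; on reals there are the four field operations and
comparisons. The only constants in a program are integers, and no conversion from reals to natural
numbers (no rounding) is available. Control flow is by branching, loops, and calls of one
parameterless, possibly recursive, procedure. -/

namespace RealRAM

structure Memory where
  nat : ℕ → ℕ → ℕ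
  real : ℕ → ℕ → ℝ

inductive NatExpr where
  | lit (k : ℕ)
  | get (a : ℕ) (i : NatExpr)
  | add (x y : NatExpr)
  | sub (x y : NatExpr)

inductive RealExpr where
  | lit (k : ℤ)
  | get (a : ℕ) (i : NatExpr)
  | add (x y : RealExpr)
  | sub (x y : RealExpr)
  | mul (x y : RealExpr)
  | div (x y : RealExpr)

inductive Test where
  | natEq (x y : NatExpr)
  | natLt (x y : NatExpr)
  | realLe (x y : RealExpr)
  | not (b : Test)

/-- Commands. `setNat a i e` writes the value of `e` into cell `i` of the natural number array `a`;
`setReal a i e` does the same for the real array `a`; `call` runs the procedure of the program. -/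
inductive Cmd where
  | skip
  | setNat (a : ℕ) (i e : NatExpr)
  | setReal (a : ℕ) (i : NatExpr) (e : RealExpr)
  | seq (c d : Cmd)
  | ite (b : Test) (c d : Cmd)
  | loop (b : Test) (c : Cmd)
  | call

/-- A program: its main command and the body of its procedure. -/
structure Program where
  main : Cmd
  proc : Cmd

def NatExpr.eval (m : Memory) : NatExpr → ℕ
  | lit k => k
  | get a i => m.nat a (i.eval m)
  | add x y => x.eval m + y.eval m
  | sub x y => x.eval m - y.eval m

noncomputable def RealExpr.eval (m : Memory) : RealExpr → ℝ
  | lit k => (k : ℝ)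
  | get a i => m.real a (i.eval m)
  | add x y => x.eval m + y.eval m
  | sub x y => x.eval m - y.eval m
  | mul x y => x.eval m * y.eval m
  | div x y => x.eval m / y.eval m

def Test.Holds (m : Memory) : Test → Prop
  | natEq x y => x.eval m = y.eval m
  | natLt x y => x.eval m < y.eval m
  | realLe x y => x.eval m ≤ y.eval m
  | not b => ¬ b.Holds m

def Memory.writeNat (m : Memory) (a i k : ℕ) : Memory :=
  { m with nat := Function.update m.nat a (Function.update (m.nat a) i k) }

def Memory.writeReal (m : Memory) (a i : ℕ) (x : ℝ) : Memory :=
  { m with real := Function.update m.real a (Function.update (m.real a) i x) }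

open Classical in
/-- One step of the machine. A state is the stack of commands that remain to be executed,
together with the memory; the machine has halted when the stack is empty. The argument `p` is the
body of the procedure. A program is a fixed finite object, so each step performs a bounded number
of memory accesses and arithmetic operations. -/
noncomputable def step (p : Cmd) : List Cmd × Memory → List Cmd × Memory
  | ([], m) => ([], m)
  | (.skip :: K, m) => (K, m)
  | (.setNat a i e :: K, m) => (K, m.writeNat a (i.eval m) (e.eval m))
  | (.setReal a i e :: K, m) => (K, m.writeReal a (i.eval m) (e.eval m))
  | (.seq c d :: K, m) => (c :: d :: K, m)
  | (.ite b c d :: K, m) => if b.Holds m then (c :: K, m) else (d :: K, m)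
  | (.loop b c :: K, m) => if b.Holds m then (c :: .loop b c :: K, m) else (K, m)
  | (.call :: K, m) => (p :: K, m)

/-- Started with memory `m`, the program halts after at most `T` steps with final memory `m'`. -/
def Program.HaltsWithin (P : Program) (m : Memory) (T : ℕ) (m' : Memory) : Prop :=
  (step P.proc)^[T] ([P.main], m) = ([], m')

end RealRAM

namespace TwoSpin

/-- `E` lists every edge of `G` exactly once, in any order and with arbitrarily ordered
endpoints. -/
def IsEdgeList {V : Type*} (G : SimpleGraph V) (E : List (V × V)) : Prop :=
  (E.map fun e => s(e.1, e.2)).Nodup ∧ ∀ u v, G.Adj u v ↔ s(u, v) ∈ E.map fun e => s(e.1, e.2)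

/-- The initial memory. Natural number array `0` starts with the number of vertices and the number
of edges; arrays `1` and `2` hold the two endpoints of the edges. Real array `0` starts with
`β, γ, ε`; real array `1` holds the external field. All other cells are `0`. -/
noncomputable def inputMemory {n : ℕ} (β γ ε : ℝ) (π : Fin n → ℝ) (E : List (Fin n × Fin n)) :
    RealRAM.Memory where
  nat
    | 0, i => [n, E.length].getD i 0
    | 1, i => (E.map fun e => (e.1 : ℕ)).getD i 0
    | 2, i => (E.map fun e => (e.2 : ℕ)).getD i 0
    | _, _ => 0
  real
    | 0, i => [β, γ, ε].getD i 0
    | 1, i => (List.ofFn π).getD i 0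
    | _, _ => 0

/-- The output is read off from cell `0` of the real array `2`. -/
def output (m : RealRAM.Memory) : ℝ := m.real 2 0

end TwoSpin

/-! Put b = βγ and let A be the set of vertices of spin 0. The edge weights can be normalised to b,
1, 1 at the price of dividing π(v) by γ^deg(v) and pulling out γ^|E|
(`partitionFunction_eq_reducedZ`). If the vertices are then deleted one after another, Z becomes a
product of factors 1 + R, where R is the ratio of the weights of spin 0 and spin 1 at the deleted
vertex in the graph that is left (`reducedZ_eq_mul`). As each factor is at least 1, an additive
error ε/n in every R costs a relative error of at most ε in total.

The ratio at v obeys a tree recursion in the style of Weitz. Delete v and multiply the fields at its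
neighbours by b one at a time: the quotient telescopes, and each factor is (1 + br)/(1 + r), where r
is the ratio at that neighbour in the graph without v (`spinRatio_eq_boostOn`, `reducedZ_update`).
On the logarithmic scale r ↦ (1 + br)/(1 + r) is increasing and contracts by θ = (√b - 1)/(√b + 1) =
1/Δ_c (`log_influence_sub_le`). Below the root the parent is deleted, so at most Δ - 1 branches
remain: each further level multiplies the uncertainty by α = (Δ - 1)/Δ_c < 1 and the work by about Δ
- 1 (`exploreSpec_succ`). The recursion starts from trivial enclosures of logarithmic length Δ log
b, so a depth L of order log(nλ/ε)/(-log α) suffices, and (Δ - 1)^L gives the claimed power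
(`exists_depth`). The program never computes L: it deepens the search by one until its own interval
is short enough. For Δ ≥ 3 the cost of all these attempts is a geometric sum dominated by the last
one.

For Δ = 2 the exponent is 0, so the time has to be linear whatever ε is, and an exact algorithm is
used. Components are paths and cycles; one vertex is deleted, two fields record its two spins, and
what remains is peeled off from the ends by summing out leaves (`reducedZ_erase_leaf`).

Correctness and running time are proved together, in a weakest precondition calculus whose
postconditions see the clock. -/

namespace RealRAM

/-! ### Program logic for the machine: weakest preconditions with a step count. -/

/-- `Exec p c m k m'`: the command `c` turns the memory `m` into `m'` in exactly `k` steps. -/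
def Exec (p c : Cmd) (m : Memory) (k : ℕ) (m' : Memory) : Prop :=
  ∀ K, (step p)^[k] (c :: K, m) = (K, m')

/-- Weakest precondition with a clock: if `c` is started in memory `m` at time `t`, then it
terminates, and the final memory and time satisfy `Q`. -/
def WP (p c : Cmd) (Q : Memory → ℕ → Prop) (m : Memory) (t : ℕ) : Prop :=
  ∃ k m', Exec p c m k m' ∧ Q m' (t + k)

variable {p c d : Cmd} {Q Q' : Memory → ℕ → Prop} {m : Memory} {t : ℕ}

theorem WP.mono (h : WP p c Q m t) (hQ : ∀ m' t', Q m' t' → Q' m' t') : WP p c Q' m t := by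
  obtain ⟨k, m', h1, h2⟩ := h
  exact ⟨k, m', h1, hQ _ _ h2⟩

theorem WP.of_step {s : ℕ} {m₁ : Memory} (c₁ : Cmd) (hs : s = t + 1)
    (hstep : ∀ K, step p (c :: K, m) = (c₁ :: K, m₁)) (h : WP p c₁ Q m₁ s) : WP p c Q m t := by
  obtain ⟨k, m', h1, h2⟩ := h
  refine ⟨k + 1, m', fun K => ?_, ?_⟩
  · rw [Function.iterate_succ_apply, hstep, h1]
  · rwa [show t + (k + 1) = s + k by omega]

theorem WP.of_halt {m₁ : Memory} (hstep : ∀ K, step p (c :: K, m) = (K, m₁))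
    (h : Q m₁ (t + 1)) : WP p c Q m t :=
  ⟨1, m₁, fun K => by simp [hstep], h⟩

theorem WP.skip (h : Q m (t + 1)) : WP p .skip Q m t :=
  .of_halt (fun _ => rfl) h

theorem WP.setNat {a : ℕ} {i e : NatExpr} (h : Q (m.writeNat a (i.eval m) (e.eval m)) (t + 1)) :
    WP p (.setNat a i e) Q m t :=
  .of_halt (fun _ => rfl) h

theorem WP.setReal {a : ℕ} {i : NatExpr} {e : RealExpr}
    (h : Q (m.writeReal a (i.eval m) (e.eval m)) (t + 1)) : WP p (.setReal a i e) Q m t :=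
  .of_halt (fun _ => rfl) h

theorem WP.seq (h : WP p c (fun m' t' => WP p d Q m' t') m (t + 1)) : WP p (.seq c d) Q m t := by
  obtain ⟨k, m', h1, l, m'', h2, h3⟩ := h
  refine ⟨l + k + 1, m'', fun K => ?_, ?_⟩
  · rw [Function.iterate_succ_apply, step, Function.iterate_add_apply, h1, h2]
  · rwa [show t + (l + k + 1) = t + 1 + k + l by omega]

theorem WP.ite {b : Test} (h1 : b.Holds m → WP p c Q m (t + 1))
    (h2 : ¬ b.Holds m → WP p d Q m (t + 1)) : WP p (.ite b c d) Q m t := by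
  by_cases hb : b.Holds m
  · exact .of_step c rfl (fun K => by simp [step, hb]) (h1 hb)
  · exact .of_step d rfl (fun K => by simp [step, hb]) (h2 hb)

theorem WP.call (h : WP p p Q m (t + 1)) : WP p .call Q m t :=
  .of_step p rfl (fun _ => rfl) h

/-- Loop rule: `I j` is the invariant after `j` rounds, and at most `N` rounds are made. -/
theorem WP.loop {b : Test} (I : ℕ → Memory → ℕ → Prop) (N : ℕ) (h0 : I 0 m t)
    (h : ∀ j m t, I j m t → (¬ b.Holds m → Q m (t + 1)) ∧
      (b.Holds m → j < N ∧ WP p c (I (j + 1)) m (t + 1))) : WP p (.loop b c) Q m t := by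
  -- The induction is on the number r of rounds that are still allowed.
  suffices H : ∀ r j m t, r + j = N → I j m t → WP p (.loop b c) Q m t from
    H N 0 m t (by simp) h0
  intro r
  induction r with
  | zero =>
    intro j m t hj hI
    have hb : ¬ b.Holds m := fun hb => by have := ((h j m t hI).2 hb).1; omega
    exact .of_halt (fun K => by simp [step, hb]) ((h j m t hI).1 hb)
  | succ r ih =>
    intro j m t hj hI
    by_cases hb : b.Holds m
    · obtain ⟨-, k, m', h1, h2⟩ := (h j m t hI).2 hb
      obtain ⟨l, m'', h3, h4⟩ := ih (j + 1) m' _ (by omega) h2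
      refine ⟨l + k + 1, m'', fun K => ?_, ?_⟩
      · rw [Function.iterate_succ_apply, step, if_pos hb, Function.iterate_add_apply, h1, h3]
      · rwa [show t + (l + k + 1) = t + 1 + k + l by omega]
    · exact .of_halt (fun K => by simp [step, hb]) ((h j m t hI).1 hb)

theorem Program.HaltsWithin.of_wp {P : Program} (h : WP P.proc P.main Q m 0) :
    ∃ T m', P.HaltsWithin m T m' ∧ Q m' T := by
  obtain ⟨k, m', h1, h2⟩ := h
  exact ⟨k, m', h1 [], by simpa using h2⟩

section Memory

variable {a i k : ℕ} {x : ℝ}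

@[simp] theorem Memory.writeNat_real : (m.writeNat a i k).real = m.real := rfl

@[simp] theorem Memory.writeReal_nat : (m.writeReal a i x).nat = m.nat := rfl

@[simp] theorem Memory.writeNat_same : (m.writeNat a i k).nat a = Function.update (m.nat a) i k := by
  simp [writeNat]

@[simp] theorem Memory.writeReal_same :
    (m.writeReal a i x).real a = Function.update (m.real a) i x := by
  simp [writeReal]

@[simp] theorem Memory.writeNat_of_ne {a' : ℕ} (h : a' ≠ a) :
    (m.writeNat a i k).nat a' = m.nat a' := by
  simp [writeNat, h]

@[simp] theorem Memory.writeReal_of_ne {a' : ℕ} (h : a' ≠ a) :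
    (m.writeReal a i x).real a' = m.real a' := by
  simp [writeReal, h]

end Memory

attribute [simp] NatExpr.eval RealExpr.eval Test.Holds

/-- The scalar variable stored in cell `0` of the natural number array `a`. -/
abbrev nvar (a : ℕ) : NatExpr := .get a (.lit 0)

/-- The scalar variable stored in cell `0` of the real array `a`. -/
abbrev rvar (a : ℕ) : RealExpr := .get a (.lit 0)

/-- The expression `k * e`. -/
def NatExpr.smul : ℕ → NatExpr → NatExpr
  | 0, _ => .lit 0
  | k + 1, e => .add (smul k e) e

@[simp] theorem NatExpr.eval_smul (k : ℕ) (e : NatExpr) : (smul k e).eval m = k * e.eval m := by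
  induction k with
  | zero => simp [smul]
  | succ k ih => simp [smul, ih]; ring

/-- The expression `e ^ k`. -/
def RealExpr.pow (e : RealExpr) : ℕ → RealExpr
  | 0 => .lit 1
  | k + 1 => .mul (pow e k) e

@[simp] theorem RealExpr.eval_pow (k : ℕ) (e : RealExpr) : (pow e k).eval m = e.eval m ^ k := by
  induction k with
  | zero => simp [pow]
  | succ k ih => simp [pow, ih, pow_succ]

end RealRAM

/-! ### The normalised partition function, the tree recursion and its contraction. -/

namespace TwoSpin

open Finset

section Reduced

variable {V : Type*} [LinearOrder V] (G : SimpleGraph V) (b : ℝ)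

open Classical in
/-- The weight `b ^ e(A)`, where `e(A)` is the number of edges inside `A`. -/
noncomputable def innerWeight (A : Finset V) : ℝ :=
  ∏ u ∈ A, ∏ w ∈ A, if u < w ∧ G.Adj u w then b else 1

/-- The partition function of the vertex set `S` with interactions `b, 1, 1` and field `p`. Fixing
the spin of a vertex to `1` amounts to deleting it. -/
noncomputable def reducedZ (S : Finset V) (p : V → ℝ) : ℝ :=
  ∑ A ∈ S.powerset, innerWeight G b A * ∏ v ∈ A, p v

open Classical in
/-- The field after the spin of `v` has been fixed to `0`. -/
noncomputable def boost (v : V) (p : V → ℝ) : V → ℝ :=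
  fun u => if G.Adj v u then p u * b else p u

/-- The ratio of the weights of spin `0` and spin `1` at `v`. -/
noncomputable def spinRatio (S : Finset V) (p : V → ℝ) (v : V) : ℝ :=
  p v * reducedZ G b (S.erase v) (boost G b v p) / reducedZ G b (S.erase v) p

variable {G b}

open Classical in
theorem innerWeight_insert {A : Finset V} {v : V} (hv : v ∉ A) :
    innerWeight G b (insert v A) =
      innerWeight G b A * ∏ u ∈ A, if G.Adj v u then b else 1 := by
  unfold innerWeight
  rw [prod_insert hv]
  have h1 : ∀ u ∈ A, (∏ w ∈ insert v A, if u < w ∧ G.Adj u w then b else 1) =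
      (if u < v ∧ G.Adj u v then b else 1) * ∏ w ∈ A, if u < w ∧ G.Adj u w then b else 1 :=
    fun u _ => prod_insert hv
  rw [prod_congr rfl h1, prod_insert hv, prod_mul_distrib, ← mul_assoc, mul_comm]
  congr 1
  simp only [lt_self_iff_false, false_and, if_false, one_mul]
  rw [← prod_mul_distrib]
  refine prod_congr rfl fun u hu => ?_
  have hne : u ≠ v := fun h => hv (h ▸ hu)
  rcases lt_or_gt_of_ne hne with h | h <;> simp [h, h.not_gt, G.adj_comm]

/-- Split the sets A according to whether they contain v. The edges from v into A give one factor b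
for each neighbour in A, and `boost` moves these factors into the field. -/
theorem reducedZ_insert {S : Finset V} {v : V} (hv : v ∉ S) (p : V → ℝ) :
    reducedZ G b (insert v S) p = reducedZ G b S p + p v * reducedZ G b S (boost G b v p) := by
  classical
  unfold reducedZ
  rw [sum_powerset_insert hv, mul_sum]
  congr 1
  refine sum_congr rfl fun A hA => ?_
  have hvA : v ∉ A := fun h => hv (mem_powerset.1 hA h)
  rw [innerWeight_insert hvA, prod_insert hvA]
  have : ∏ u ∈ A, boost G b v p u = (∏ u ∈ A, if G.Adj v u then b else 1) * ∏ u ∈ A, p u := by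
    rw [← prod_mul_distrib]
    refine prod_congr rfl fun u _ => ?_
    by_cases h : G.Adj v u <;> simp [boost, h, mul_comm]
  rw [this]
  ring

theorem reducedZ_erase {S : Finset V} {v : V} (hv : v ∈ S) (p : V → ℝ) :
    reducedZ G b S p =
      reducedZ G b (S.erase v) p + p v * reducedZ G b (S.erase v) (boost G b v p) := by
  conv_lhs => rw [← insert_erase hv]
  exact reducedZ_insert (notMem_erase v S) p

theorem reducedZ_congr {S : Finset V} {p q : V → ℝ} (h : ∀ u ∈ S, p u = q u) :
    reducedZ G b S p = reducedZ G b S q :=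
  sum_congr rfl fun A hA => by
    rw [prod_congr rfl fun u hu => h u (mem_powerset.1 hA hu)]

@[simp] theorem reducedZ_empty (p : V → ℝ) : reducedZ G b ∅ p = 1 := by
  simp [reducedZ, innerWeight]

theorem reducedZ_pos (hb : 0 < b) {S : Finset V} {p : V → ℝ} (hp : ∀ u ∈ S, 0 < p u) :
    0 < reducedZ G b S p := by
  refine sum_pos (fun A hA => mul_pos ?_ (prod_pos fun u hu => hp u (mem_powerset.1 hA hu)))
    (powerset_nonempty S)
  refine prod_pos fun u _ => prod_pos fun w _ => ?_
  split_ifs <;> simp [hb]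

theorem boost_pos {W : Type*} {G : SimpleGraph W} (hb : 0 < b) {S : Finset W} {p : W → ℝ}
    (hp : ∀ u ∈ S, 0 < p u) (v : W) :
    ∀ u ∈ S, 0 < boost G b v p u := by
  intro u hu
  unfold boost
  split_ifs
  · exact mul_pos (hp u hu) hb
  · exact hp u hu

theorem spinRatio_pos (hb : 0 < b) {S : Finset V} {p : V → ℝ} (hp : ∀ u ∈ S, 0 < p u) {v : V}
    (hv : v ∈ S) : 0 < spinRatio G b S p v := by
  have hp' : ∀ u ∈ S.erase v, 0 < p u := fun u hu => hp u (mem_of_mem_erase hu)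
  exact div_pos (mul_pos (hp v hv) (reducedZ_pos hb (boost_pos hb hp' v))) (reducedZ_pos hb hp')

/-- The factorisation behind the approximation algorithm: iterated over all vertices, it turns the
partition function into a product of factors 1 + R. -/
theorem reducedZ_eq_mul (hb : 0 < b) {S : Finset V} {p : V → ℝ} (hp : ∀ u ∈ S, 0 < p u) {v : V}
    (hv : v ∈ S) :
    reducedZ G b S p = reducedZ G b (S.erase v) p * (1 + spinRatio G b S p v) := by
  have h := reducedZ_pos (G := G) hb fun u hu => hp u (mem_of_mem_erase (a := v) hu)
  rw [reducedZ_erase hv, spinRatio]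
  field_simp

/-- The influence of a neighbour whose ratio of spin weights is `r`. -/
noncomputable def influence (b r : ℝ) : ℝ := (1 + b * r) / (1 + r)

theorem influence_pos (hb : 0 < b) {r : ℝ} (hr : 0 < r) : 0 < influence b r := by
  unfold influence; positivity

theorem one_le_influence (hb : 1 < b) {r : ℝ} (hr : 0 < r) : 1 ≤ influence b r := by
  rw [influence, le_div_iff₀ (by linarith)]; nlinarith

theorem influence_le (hb : 1 < b) {r : ℝ} (hr : 0 < r) : influence b r ≤ b := by
  rw [influence, div_le_iff₀ (by linarith)]; nlinarith

theorem influence_mono (hb : 1 < b) {r s : ℝ} (hr : 0 < r) (hrs : r ≤ s) :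
    influence b r ≤ influence b s := by
  rw [influence, influence, div_le_div_iff₀ (by linarith) (by linarith)]; nlinarith

/-- The contraction of the recursion, on the logarithmic scale. -/
theorem log_influence_sub_le (hb : 1 < b) {r s : ℝ} (hr : 0 < r) (hrs : r ≤ s) :
    Real.log (influence b s) - Real.log (influence b r) ≤
      (√b - 1) / (√b + 1) * (Real.log s - Real.log r) := by
  set c := √b with hc
  have hcb : b = c ^ 2 := (Real.sq_sqrt (by linarith)).symm
  have hc1 : 1 < c := by rw [hc]; exact Real.lt_sqrt_of_sq_lt (by simpa using hb)
  have hmono : MonotoneOn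
      (fun x => (c - 1) / (c + 1) * Real.log x - (Real.log (1 + b * x) - Real.log (1 + x)))
      (Set.Ioi 0) := by
    have hder : ∀ x ∈ Set.Ioi (0 : ℝ), HasDerivAt
        (fun x => (c - 1) / (c + 1) * Real.log x - (Real.log (1 + b * x) - Real.log (1 + x)))
        ((c - 1) / (c + 1) * x⁻¹ - (b / (1 + b * x) - 1 / (1 + x))) x := by
      intro x hx
      have hx : 0 < x := hx
      have h1 : HasDerivAt (fun x => 1 + b * x) b x := by
        simpa using ((hasDerivAt_id x).const_mul b).const_add 1
      have h2 : HasDerivAt (fun x : ℝ => 1 + x) 1 x := (hasDerivAt_id x).const_add 1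
      exact ((Real.hasDerivAt_log hx.ne').const_mul _).sub
        ((h1.log (by positivity)).sub (h2.log (by positivity)))
    refine monotoneOn_of_deriv_nonneg (convex_Ioi 0)
      (fun x hx => (hder x hx).continuousAt.continuousWithinAt) ?_ ?_
    · intro x hx
      rw [interior_Ioi] at hx
      exact (hder x hx).differentiableAt.differentiableWithinAt
    · intro x hx
      rw [interior_Ioi] at hx
      rw [(hder x hx).deriv]
      have hx : 0 < x := hx
      -- The derivative is a nonnegative multiple of the square (c x - 1)^2, where c = √b. It
      -- vanishes at x = 1/√b, so the contraction constant is sharp.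
      have : (c - 1) / (c + 1) * x⁻¹ - (b / (1 + b * x) - 1 / (1 + x)) =
          (c - 1) * (c * x - 1) ^ 2 / ((c + 1) * x * (1 + b * x) * (1 + x)) := by
        rw [hcb]; field_simp; ring
      rw [this]
      have : 0 ≤ c - 1 := by linarith
      positivity
  have h := hmono (Set.mem_Ioi.2 hr) (Set.mem_Ioi.2 (hr.trans_le hrs)) hrs
  have hs := hr.trans_le hrs
  rw [influence, influence, Real.log_div (by positivity) (by positivity),
    Real.log_div (by positivity) (by positivity)]
  simp only at h
  linarith

/-- Fixing one copy of a neighbour of `u` to spin `0`. -/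
theorem reducedZ_update (hb : 0 < b) {S : Finset V} {p : V → ℝ} (hp : ∀ u ∈ S, 0 < p u) {u : V}
    (hu : u ∈ S) :
    reducedZ G b S (Function.update p u (p u * b)) =
      reducedZ G b S p * influence b (spinRatio G b S p u) := by
  have hR := spinRatio_pos (G := G) hb hp hu
  have h := reducedZ_pos (G := G) hb fun w hw => hp w (mem_of_mem_erase (a := u) hw)
  rw [reducedZ_eq_mul hb hp hu, influence, reducedZ_erase hu]
  -- With u deleted or its spin fixed, the field at u is irrelevant inside both partition functions;
  -- only the prefactor of the second summand gains a b.
  have h1 : reducedZ G b (S.erase u) (Function.update p u (p u * b)) =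
      reducedZ G b (S.erase u) p :=
    reducedZ_congr fun w hw => by simp [ne_of_mem_erase hw]
  have h2 : reducedZ G b (S.erase u) (boost G b u (Function.update p u (p u * b))) =
      reducedZ G b (S.erase u) (boost G b u p) :=
    reducedZ_congr fun w hw => by simp [boost, ne_of_mem_erase hw]
  rw [h1, h2]
  have h3 : p u * reducedZ G b (S.erase u) (boost G b u p) =
      spinRatio G b S p u * reducedZ G b (S.erase u) p := by
    rw [spinRatio]; field_simp
  rw [Function.update_self, mul_right_comm, h3]
  field_simp

open Classical in
/-- The field after the neighbours in `l` that belong to `S` have been multiplied by `b`. -/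
noncomputable def boostOn (b : ℝ) (S : Finset V) (l : List V) (p : V → ℝ) : V → ℝ :=
  fun u => if u ∈ l ∧ u ∈ S then p u * b else p u

theorem boostOn_nil (S : Finset V) (p : V → ℝ) : boostOn b S [] p = p := by
  funext u; simp [boostOn]

theorem boostOn_concat_of_mem {S : Finset V} {l : List V} {u : V} (hu : u ∈ S) (hl : u ∉ l)
    (p : V → ℝ) : boostOn b S (l ++ [u]) p =
      Function.update (boostOn b S l p) u (boostOn b S l p u * b) := by
  funext w
  by_cases h : w = u
  · subst h; simp [boostOn, hu, hl]
  · simp [boostOn, h]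

theorem boostOn_concat_of_notMem {S : Finset V} {l : List V} {u : V} (hu : u ∉ S)
    (p : V → ℝ) : boostOn b S (l ++ [u]) p = boostOn b S l p := by
  funext w
  by_cases h : w = u
  · subst h; simp [boostOn, hu]
  · simp [boostOn, h]

theorem boostOn_pos (hb : 0 < b) {S T : Finset V} {p : V → ℝ} (hp : ∀ u ∈ S, 0 < p u)
    (l : List V) : ∀ u ∈ S, 0 < boostOn b T l p u := by
  intro u hu
  unfold boostOn
  split_ifs
  · exact mul_pos (hp u hu) hb
  · exact hp u hu

theorem reducedZ_boostOn {S : Finset V} {l : List V} {v : V} (hl : ∀ u, u ∈ l ↔ G.Adj v u)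
    (p : V → ℝ) : reducedZ G b S (boostOn b S l p) = reducedZ G b S (boost G b v p) :=
  reducedZ_congr fun u hu => by
    by_cases h : G.Adj v u
    · simp [boostOn, boost, hu, h, (hl u).2 h]
    · simp [boostOn, boost, h, mt (hl u).1 h]

/-- With the neighbours in a list the quotient telescopes: by `reducedZ_update`, appending a
neighbour that lies in the set multiplies the numerator by one `influence`. This is the recursion
that `explore` evaluates. -/
theorem spinRatio_eq_boostOn {S : Finset V} {l : List V} {v : V} (hl : ∀ u, u ∈ l ↔ G.Adj v u)
    (p : V → ℝ) : spinRatio G b S p v =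
      p v * (reducedZ G b (S.erase v) (boostOn b (S.erase v) l p) /
        reducedZ G b (S.erase v) p) := by
  rw [reducedZ_boostOn hl, spinRatio, mul_div_assoc]

/-- Every neighbour in S contributes one factor `influence`, which lies between 1 and b. -/
theorem reducedZ_boostOn_le (hb : 1 < b) {S : Finset V} {p : V → ℝ} (hp : ∀ u ∈ S, 0 < p u)
    {l : List V} (hl : l.Nodup) :
    reducedZ G b S (boostOn b S l p) ≤ b ^ l.length * reducedZ G b S p ∧
      reducedZ G b S p ≤ reducedZ G b S (boostOn b S l p) := by
  have hb0 : 0 < b := by linarith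
  induction l using List.reverseRecOn with
  | nil => simp [boostOn_nil]
  | append_singleton l u ih =>
    have hl' : l.Nodup ∧ u ∉ l := by
      have := List.nodup_append.1 hl
      exact ⟨this.1, fun h => this.2.2 u h u (by simp) rfl⟩
    obtain ⟨h1, h2⟩ := ih hl'.1
    have hpos := reducedZ_pos (G := G) hb0 hp
    have hpos' := reducedZ_pos (G := G) hb0 (boostOn_pos (T := S) hb0 hp l)
    by_cases hu : u ∈ S
    · have hR := spinRatio_pos (G := G) hb0 (boostOn_pos (T := S) hb0 hp l) hu
      rw [boostOn_concat_of_mem hu hl'.2, reducedZ_update hb0 (boostOn_pos hb0 hp l) hu]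
      constructor
      · calc _ ≤ (b ^ l.length * reducedZ G b S p) * b :=
              mul_le_mul h1 (influence_le hb hR) (influence_pos hb0 hR).le (by positivity)
          _ = _ := by simp [pow_succ]; ring
      · exact h2.trans (le_mul_of_one_le_right hpos'.le (one_le_influence hb hR))
    · rw [boostOn_concat_of_notMem hu]
      refine ⟨h1.trans ?_, h2⟩
      have : b ^ l.length ≤ b ^ (l ++ [u]).length := pow_le_pow_right₀ hb.le (by simp)
      gcongr

/-- The trivial enclosure, which only needs a degree bound. It ends the recursion, and it also
supplies the absolute bound that turns logarithmic into additive errors. -/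
theorem spinRatio_bounds (hb : 1 < b) {S : Finset V} {p : V → ℝ} (hp : ∀ u ∈ S, 0 < p u)
    {l : List V} (hl : l.Nodup) {v : V} (hv : v ∈ S) (hlv : ∀ u, u ∈ l ↔ G.Adj v u) {d : ℕ}
    (hd : l.length ≤ d) : p v ≤ spinRatio G b S p v ∧ spinRatio G b S p v ≤ p v * b ^ d := by
  have hp' : ∀ u ∈ S.erase v, 0 < p u := fun u hu => hp u (mem_of_mem_erase hu)
  have hpos := reducedZ_pos (G := G) (by linarith) hp'
  obtain ⟨h1, h2⟩ := reducedZ_boostOn_le (G := G) hb hp' hl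
  rw [spinRatio_eq_boostOn hlv]
  have hpv := hp v hv
  constructor
  · exact le_mul_of_one_le_right hpv.le ((one_le_div hpos).2 h2)
  · gcongr
    rw [div_le_iff₀ hpos]
    refine h1.trans ?_
    have : b ^ l.length ≤ b ^ d := pow_le_pow_right₀ hb.le hd
    gcongr

/-- Elimination of a vertex without neighbours. -/
theorem reducedZ_erase_isolated {S : Finset V} {x : V} (hx : x ∈ S)
    (h : ∀ w ∈ S, ¬ G.Adj x w) (p : V → ℝ) :
    reducedZ G b S p = (1 + p x) * reducedZ G b (S.erase x) p := by
  rw [reducedZ_erase hx, reducedZ_congr (p := boost G b x p) (q := p)]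
  · ring
  · intro u hu
    simp [boost, h u (mem_of_mem_erase hu)]

/-- Elimination of a vertex with a single neighbour. -/
theorem reducedZ_erase_leaf {S : Finset V} {x w : V} (hx : x ∈ S) (hw : w ∈ S)
    (hxw : G.Adj x w) (h : ∀ u ∈ S, G.Adj x u → u = w) {p : V → ℝ} (hp : 0 < p x) :
    reducedZ G b S p = (1 + p x) *
      reducedZ G b (S.erase x) (Function.update p w (p w * influence b (p x))) := by
  have hw' : w ∈ S.erase x := mem_erase.2 ⟨hxw.ne', hw⟩
  -- Expand at w as well. Summing over the spin of x leaves 1 + p x if w has spin 1 and 1 + b * p x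
  -- if w has spin 0; the quotient of the two is `influence b (p x)`.
  rw [reducedZ_erase hx, reducedZ_erase hw' p, reducedZ_erase hw' (boost G b x p),
    reducedZ_erase hw' (Function.update _ _ _)]
  have h1 : ∀ u ∈ (S.erase x).erase w, boost G b x p u = p u := by
    intro u hu
    have hu' := mem_erase.1 hu
    have : ¬ G.Adj x u := fun ha => hu'.1 (h u (mem_of_mem_erase hu'.2) ha)
    simp [boost, this]
  have h2 : ∀ u ∈ (S.erase x).erase w,
      Function.update p w (p w * influence b (p x)) u = p u := fun u hu => by
    simp [ne_of_mem_erase hu]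
  rw [reducedZ_congr h1, reducedZ_congr h2,
    reducedZ_congr (p := boost G b w (boost G b x p)) (q := boost G b w p),
    reducedZ_congr (p := boost G b w (Function.update _ _ _)) (q := boost G b w p)]
  · have : boost G b x p w = p w * b := by simp [boost, hxw]
    rw [this, Function.update_self, influence]
    field_simp
    ring
  · intro u hu
    simp only [boost, h2 u hu]
  · intro u hu
    simp only [boost]
    have hu' := mem_erase.1 hu
    have : ¬ G.Adj x u := fun ha => hu'.1 (h u (mem_of_mem_erase hu'.2) ha)
    simp [this]

/-- Needed because the machine names vertices by natural numbers, while the input graph lives on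
`Fin n`. -/
theorem reducedZ_map {W : Type*} [LinearOrder W] (f : V ↪ W) (S : Finset V) (p : W → ℝ) :
    reducedZ (G.map f) b (S.map f) p = reducedZ G b S (p ∘ f) := by
  induction S using Finset.induction_on generalizing p with
  | empty => simp
  | insert v S hv ih =>
    rw [map_insert, reducedZ_insert (by simpa using hv), reducedZ_insert hv, ih, ih]
    congr 3
    funext u
    have h : (G.map f).Adj (f v) (f u) ↔ G.Adj v u := SimpleGraph.map_adj_apply
    by_cases h' : G.Adj v u
    · simp [boost, h.2 h', h']
    · simp [boost, mt h.1 h', h']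

end Reduced

/-! ### Normalisation of the edge interactions. -/

section Link

variable {n : ℕ} (G : SimpleGraph (Fin n))

open Classical in
theorem ncard_edges_eq_sum (P : Fin n → Prop) :
    {e ∈ G.edgeSet | ∀ v ∈ e, P v}.ncard =
      ∑ u, ∑ w, if u < w ∧ G.Adj u w ∧ P u ∧ P w then 1 else 0 := by
  have h : {e ∈ G.edgeSet | ∀ v ∈ e, P v} = (fun x : Fin n × Fin n => s(x.1, x.2)) ''
      (({x | x.1 < x.2 ∧ G.Adj x.1 x.2 ∧ P x.1 ∧ P x.2} : Finset (Fin n × Fin n)) :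
        Set (Fin n × Fin n)) := by
    ext e
    induction e using Sym2.ind with | _ u w =>
    simp only [Set.mem_ofPred_eq, SimpleGraph.mem_edgeSet, Sym2.mem_iff, Set.mem_image,
      coe_filter, mem_univ, true_and, Prod.exists]
    constructor
    · rintro ⟨h1, h2⟩
      rcases lt_or_gt_of_ne h1.ne with h | h
      · exact ⟨u, w, ⟨h, h1, h2 u (by simp), h2 w (by simp)⟩, rfl⟩
      · exact ⟨w, u, ⟨h, h1.symm, h2 w (by simp), h2 u (by simp)⟩, Sym2.eq_swap⟩
    · rintro ⟨x, y, ⟨-, h1, h2, h3⟩, h⟩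
      rcases Sym2.eq_iff.1 h with ⟨rfl, rfl⟩ | ⟨rfl, rfl⟩
      · exact ⟨h1, by rintro v (rfl | rfl) <;> assumption⟩
      · exact ⟨h1.symm, by rintro v (rfl | rfl) <;> assumption⟩
  rw [h, Set.InjOn.ncard_image, Set.ncard_coe_finset, card_filter, Fintype.sum_prod_type]
  rintro ⟨x, y⟩ h1 ⟨x', y'⟩ h2 h
  simp only [coe_filter, mem_univ, true_and, Set.mem_ofPred_eq] at h1 h2
  rcases Sym2.eq_iff.1 h with ⟨h3, h4⟩ | ⟨h3, h4⟩
  · simp_all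
  · have := h1.1; have := h2.1; simp_all; omega

open Classical in
-- Double counting, written over the pairs u < w so that it can be compared edge by edge with the
-- counts of `ncard_edges_eq_sum`.
theorem sum_degree_eq (A : Finset (Fin n)) (d : Fin n → ℕ)
    (hd : ∀ v, d v = ∑ w, if G.Adj v w then 1 else 0) :
    ∑ v ∈ A, d v = ∑ u, ∑ w, if u < w ∧ G.Adj u w then
      (if u ∈ A then 1 else 0) + (if w ∈ A then 1 else 0) else 0 := by
  have h1 : ∑ v ∈ A, d v = ∑ u, ∑ w, if G.Adj u w ∧ u ∈ A then 1 else 0 := by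
    rw [← Finset.sum_filter_add_sum_filter_not univ (· ∈ A)]
    simp only [filter_mem_eq_inter, univ_inter]
    rw [sum_eq_zero (s := univ.filter (· ∉ A)), add_zero]
    · refine sum_congr rfl fun v hv => ?_
      simp [hd, hv]
    · intro v hv
      simp [(mem_filter.1 hv).2]
  have h2 : (∑ u, ∑ w, if G.Adj u w ∧ u ∈ A then 1 else 0) =
      (∑ u, ∑ w, if u < w ∧ G.Adj u w ∧ u ∈ A then 1 else 0) +
        ∑ u, ∑ w, if w < u ∧ G.Adj u w ∧ u ∈ A then 1 else 0 := by
    simp_rw [← sum_add_distrib]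
    refine sum_congr rfl fun u _ => sum_congr rfl fun w _ => ?_
    by_cases h : G.Adj u w
    · rcases lt_or_gt_of_ne h.ne with h' | h' <;> simp [h, h', h'.not_gt]
    · simp [h]
  rw [h1, h2, sum_comm (f := fun u w => if w < u ∧ G.Adj u w ∧ u ∈ A then 1 else 0)]
  simp_rw [← sum_add_distrib]
  refine sum_congr rfl fun u _ => sum_congr rfl fun w _ => ?_
  by_cases h : u < w <;> by_cases h' : G.Adj u w <;> simp [h, h', G.adj_comm w u]

/-- The edge interactions can be normalised to `β * γ, 1, 1`. -/
theorem partitionFunction_eq_reducedZ {β γ : ℝ} (hγ : 0 < γ) (π : Fin n → ℝ) (d : Fin n → ℕ)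
    (hd : ∀ v, d v = (G.neighborSet v).ncard) :
    partitionFunction G β γ π =
      γ ^ G.edgeSet.ncard * reducedZ G (β * γ) univ fun v => π v / γ ^ d v := by
  classical
  have hd' : ∀ v, d v = ∑ w, if G.Adj v w then 1 else 0 := by
    intro v
    rw [hd, ← card_filter, Set.ncard_eq_toFinset_card']
    congr 1
    ext w
    simp
  unfold partitionFunction reducedZ
  rw [mul_sum, powerset_univ]
  refine sum_bij' (fun σ _ => univ.filter fun v => σ v = 0)
    (fun A _ v => if v ∈ A then 0 else 1) (by simp) (by simp) ?_ ?_ ?_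
  · intro σ _
    funext v
    by_cases h : σ v = 0
    · simp [h]
    · simp [Fin.eq_one_of_ne_zero _ h]
  · intro A _
    ext v
    by_cases h : v ∈ A <;> simp [h]
  · intro σ _
    set A : Finset (Fin n) := univ.filter fun v => σ v = 0 with hA
    have hA0 : ∀ v, σ v = 0 ↔ v ∈ A := by simp [hA]
    have hA1 : ∀ v, σ v = 1 ↔ v ∉ A := by
      intro v
      rw [← hA0]
      constructor
      · intro h; simp [h]
      · exact Fin.eq_one_of_ne_zero _
    -- An edge with 0, 1 or 2 endpoints in A contributes 1, 1 or 2 to either side. This identity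
    -- lets the powers of γ be exchanged.
    have key : {e ∈ G.edgeSet | ∀ v ∈ e, σ v = 1}.ncard + ∑ v ∈ A, d v =
        G.edgeSet.ncard + {e ∈ G.edgeSet | ∀ v ∈ e, σ v = 0}.ncard := by
      have hm : G.edgeSet.ncard = ∑ u, ∑ w, if u < w ∧ G.Adj u w then 1 else 0 := by
        have := ncard_edges_eq_sum G fun _ => True
        simpa using this
      rw [hm, ncard_edges_eq_sum, ncard_edges_eq_sum, sum_degree_eq G A d hd']
      simp_rw [← sum_add_distrib, hA0, hA1]
      refine sum_congr rfl fun u _ => sum_congr rfl fun w _ => ?_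
      by_cases h : u < w <;> by_cases h' : G.Adj u w <;> by_cases hu : u ∈ A <;>
        by_cases hw : w ∈ A <;> simp [h, h', hu, hw]
    have hI : innerWeight G (β * γ) A =
        (β * γ) ^ {e ∈ G.edgeSet | ∀ v ∈ e, σ v = 0}.ncard := by
      rw [ncard_edges_eq_sum]
      simp_rw [hA0]
      rw [← prod_pow_eq_pow_sum]
      simp_rw [← prod_pow_eq_pow_sum]
      unfold innerWeight
      rw [← prod_subset (subset_univ A)]
      · refine prod_congr rfl fun u hu => ?_
        rw [← prod_subset (subset_univ A)]
        · refine prod_congr rfl fun w hw => ?_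
          by_cases h : u < w ∧ G.Adj u w
          · simp [h, hu, hw]
          · simp only [if_neg h]
            rw [if_neg (fun h' => h ⟨h'.1, h'.2.1⟩), pow_zero]
        · intro w _ hw; simp [hw]
      · intro u _ hu; simp [hu]
    rw [hI, weight, prod_div_distrib, prod_pow_eq_pow_sum, mul_pow]
    have h2 := congrArg (γ ^ ·) key
    simp only [pow_add] at h2
    have h3 : (0 : ℝ) < γ ^ ∑ v ∈ A, d v := by positivity
    field_simp
    linear_combination (β ^ {e ∈ G.edgeSet | ∀ v ∈ e, σ v = 0}.ncard * ∏ v ∈ A, π v) * h2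

end Link

end TwoSpin

/-! ### Adjacency tables and the processing of the input. -/

namespace TwoSpin

open RealRAM

/-- The neighbours of `v` recorded in an adjacency table with rows of length `Δ`. -/
def nbrs (Δ : ℕ) (deg adj : ℕ → ℕ) (v : ℕ) : List ℕ :=
  (List.range (deg v)).map fun j => adj (Δ * v + j)

@[simp] theorem length_nbrs (Δ : ℕ) (deg adj : ℕ → ℕ) (v : ℕ) :
    (nbrs Δ deg adj v).length = deg v := by simp [nbrs]

@[simp] theorem getElem_nbrs (Δ : ℕ) (deg adj : ℕ → ℕ) (v j : ℕ)
    (h : j < (nbrs Δ deg adj v).length) : (nbrs Δ deg adj v)[j] = adj (Δ * v + j) := by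
  simp [nbrs]

/-- The new entry goes to the first free cell of row u. Rows have length Δ and are filled to at most
Δ, so no cell read for another vertex is hit. -/
theorem nbrs_update {Δ : ℕ} {deg adj : ℕ → ℕ} {u : ℕ} (w v : ℕ) (hu : deg u < Δ)
    (hv : deg v ≤ Δ) :
    nbrs Δ (Function.update deg u (deg u + 1)) (Function.update adj (Δ * u + deg u) w) v =
      if v = u then nbrs Δ deg adj v ++ [w] else nbrs Δ deg adj v := by
  split_ifs with h
  · subst h
    simp only [nbrs, Function.update_self, List.range_succ, List.map_append, List.map_cons,
      List.map_nil]
    congr 1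
    refine List.map_congr_left fun j hj => ?_
    have := List.mem_range.1 hj
    rw [Function.update_of_ne (by omega)]
  · simp only [nbrs, Function.update_of_ne h]
    refine List.map_congr_left fun j hj => ?_
    have := List.mem_range.1 hj
    rw [Function.update_of_ne]
    intro h'
    rcases lt_or_gt_of_ne h with h | h
    · nlinarith
    · nlinarith

/-- The adjacency lists of the table of `m` are those of `H`. -/
structure IsAdjTable (Δ : ℕ) (H : SimpleGraph ℕ) (deg adj : ℕ → ℕ) : Prop where
  nodup : ∀ v, (nbrs Δ deg adj v).Nodup
  deg_le : ∀ v, deg v ≤ Δ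
  mem_iff : ∀ v u, u ∈ nbrs Δ deg adj v ↔ H.Adj v u

/-- The other endpoints of the edges in `E` at `v`. -/
def incident (E : List (ℕ × ℕ)) (v : ℕ) : List ℕ :=
  E.flatMap fun e => if v = e.1 then [e.2] else if v = e.2 then [e.1] else []

theorem mem_incident {E : List (ℕ × ℕ)} {v u : ℕ} :
    u ∈ incident E v ↔ s(v, u) ∈ E.map fun e => s(e.1, e.2) := by
  simp only [incident, List.mem_flatMap, List.mem_map]
  refine exists_congr fun e => and_congr_right fun _ => ?_
  rw [Sym2.eq_iff]
  split_ifs with h1 h2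
  · simp only [List.mem_singleton]
    constructor
    · rintro rfl; exact .inl ⟨h1.symm, rfl⟩
    · rintro (h | h)
      · exact h.2.symm
      · rw [← h.1, ← h1, h.2]
  · simp only [List.mem_singleton]
    constructor
    · rintro rfl; exact .inr ⟨rfl, h2.symm⟩
    · rintro (h | h)
      · exact absurd h.1.symm h1
      · exact h.1.symm
  · simp only [List.not_mem_nil, false_iff, not_or, not_and]
    exact ⟨fun h => absurd h.symm h1, fun _ h => absurd h.symm h2⟩

theorem nodup_incident {E : List (ℕ × ℕ)} (hE : (E.map fun e => s(e.1, e.2)).Nodup) (v : ℕ) :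
    (incident E v).Nodup := by
  induction E with
  | nil => simp [incident]
  | cons e E ih =>
    rw [List.map_cons, List.nodup_cons] at hE
    have h : incident (e :: E) v =
        (if v = e.1 then [e.2] else if v = e.2 then [e.1] else []) ++ incident E v := rfl
    rw [h]
    split_ifs with h1 h2
    · refine List.nodup_cons.2 ⟨fun h => hE.1 ?_, ih hE.2⟩
      rw [← h1]; exact mem_incident.1 h
    · refine List.nodup_cons.2 ⟨fun h => hE.1 ?_, ih hE.2⟩
      rw [← h2, Sym2.eq_swap]; exact mem_incident.1 h
    · exact ih hE.2

theorem length_incident_take_le (E : List (ℕ × ℕ)) (k v : ℕ) :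
    (incident (E.take k) v).length ≤ (incident E v).length := by
  have h : incident E v = incident (E.take k) v ++ incident (E.drop k) v := by
    rw [incident, incident, incident, ← List.flatMap_append, List.take_append_drop]
  rw [h, List.length_append]
  exact Nat.le_add_right _ _

theorem incident_take_succ (E : List (ℕ × ℕ)) {k : ℕ} (hk : k < E.length) (v : ℕ) :
    incident (E.take (k + 1)) v = incident (E.take k) v ++
      if v = E[k].1 then [E[k].2] else if v = E[k].2 then [E[k].1] else [] := by
  rw [← List.take_concat_get' E k hk, incident, List.flatMap_append]
  simp [incident]

/-- Appends `w` to the adjacency list of `u` and divides the field at `u` by `γ`. -/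
def addNbr (Δ : ℕ) (u w : NatExpr) : Cmd :=
  .seq (.setNat 5 (.add (.smul Δ u) (.get 4 u)) w)
    (.seq (.setNat 4 u (.add (.get 4 u) (.lit 1)))
      (.setReal 1 u (.div (.get 1 u) (.get 0 (.lit 1)))))

/-- Reads the list of edges. -/
def readEdges (Δ : ℕ) : Cmd :=
  .loop (.natLt (nvar 6) (.get 0 (.lit 1)))
    (.seq (addNbr Δ (.get 1 (nvar 6)) (.get 2 (nvar 6)))
      (.seq (addNbr Δ (.get 2 (nvar 6)) (.get 1 (nvar 6)))
        (.seq (.setReal 2 (.lit 0) (.mul (rvar 2) (.get 0 (.lit 1))))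
          (.setNat 6 (.lit 0) (.add (nvar 6) (.lit 1))))))

/-- Makes a copy of the field and converts the number of vertices to a real number. -/
def copyField : Cmd :=
  .loop (.natLt (nvar 6) (nvar 0))
    (.seq (.setReal 7 (.lit 0) (.add (rvar 7) (.lit 1)))
      (.seq (.setReal 10 (nvar 6) (.get 1 (nvar 6)))
        (.setNat 6 (.lit 0) (.add (nvar 6) (.lit 1)))))

/-- The common initialisation of the algorithms. -/
def setup (Δ : ℕ) : Cmd :=
  .seq (.setReal 2 (.lit 0) (.lit 1))
    (.seq (.setReal 5 (.lit 0) (.mul (rvar 0) (.get 0 (.lit 1))))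
      (.seq (.setReal 6 (.lit 0) (.pow (rvar 5) Δ))
        (.seq (readEdges Δ)
          (.seq (.setNat 6 (.lit 0) (.lit 0))
            (.seq copyField (.setNat 6 (.lit 0) (.lit 0)))))))

/-- The memory after `k` edges have been read, starting from `m₀`. -/
structure EdgesRead (Δ : ℕ) (E : List (ℕ × ℕ)) (m₀ : Memory) (k : ℕ) (m : Memory) : Prop where
  nat_eq : ∀ a, a < 4 ∨ 6 < a → m.nat a = m₀.nat a
  counter : m.nat 6 0 = k
  nbrs_eq : ∀ v, nbrs Δ (m.nat 4) (m.nat 5) v = incident (E.take k) v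
  real_eq : ∀ a, a < 1 ∨ 2 < a → m.real a = m₀.real a
  field : ∀ v, m.real 1 v = m₀.real 1 v / m₀.real 0 1 ^ m.nat 4 v
  out : m.real 2 0 = m₀.real 0 1 ^ k

/-- A partly filled table is described by `incident` of a prefix of E. The degrees recorded so far
are also the exponents of γ by which the field has been divided. -/
theorem readEdges_spec {Δ : ℕ} {p : Cmd} {m₀ : Memory} {t : ℕ} {E : List (ℕ × ℕ)}
    {Q : Memory → ℕ → Prop} (hlen : m₀.nat 0 1 = E.length)
    (hE1 : ∀ k (h : k < E.length), m₀.nat 1 k = E[k].1)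
    (hE2 : ∀ k (h : k < E.length), m₀.nat 2 k = E[k].2) (hne : ∀ e ∈ E, e.1 ≠ e.2)
    (hdeg : ∀ v, (incident E v).length ≤ Δ) (h0 : EdgesRead Δ E m₀ 0 m₀)
    (hQ : ∀ m t', EdgesRead Δ E m₀ E.length m → t' ≤ t + 16 * E.length + 1 → Q m t') :
    WP p (readEdges Δ) Q m₀ t := by
  refine .loop (fun k m t' => k ≤ E.length ∧ EdgesRead Δ E m₀ k m ∧ t' ≤ t + 16 * k) E.length
    ⟨by simp, h0, by simp⟩ ?_
  rintro k m t' ⟨hk, h, ht⟩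
  have hlen' : m.nat 0 1 = E.length := by rw [h.nat_eq 0 (by simp), hlen]
  constructor
  · intro hb
    simp [h.counter, hlen'] at hb
    have : k = E.length := by omega
    subst this
    exact hQ _ _ h (by omega)
  intro hb
  simp [h.counter, hlen'] at hb
  refine ⟨hb, ?_⟩
  set a := E[k].1 with ha
  set c := E[k].2 with hc
  have hac : a ≠ c := hne _ (List.getElem_mem hb)
  have h1 : m.nat 1 k = a := by rw [h.nat_eq 1 (by simp), hE1 k hb]
  have h2 : m.nat 2 k = c := by rw [h.nat_eq 2 (by simp), hE2 k hb]
  have hγ : m.real 0 = m₀.real 0 := h.real_eq 0 (by simp)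
  have hdegk : ∀ v, m.nat 4 v = (incident (E.take k) v).length := fun v => by
    rw [← h.nbrs_eq, length_nbrs]
  have hle : ∀ v, m.nat 4 v ≤ Δ := fun v => by
    rw [hdegk]; exact (length_incident_take_le E k v).trans (hdeg v)
  have hstep := incident_take_succ E hb
  -- The bound Δ still holds once edge k has been counted, so before that both endpoints have a free
  -- cell.
  have hlt : ∀ v, v = a ∨ v = c → m.nat 4 v < Δ := by
    intro v hv
    have h3 := (length_incident_take_le E (k + 1) v).trans (hdeg v)
    rw [hstep] at h3
    rw [hdegk]
    rcases hv with rfl | rfl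
    · simp [← ha] at h3; omega
    · simp [← ha, ← hc, hac.symm] at h3; omega
  unfold addNbr
  repeat' first | apply WP.seq | apply WP.setNat | apply WP.setReal
  refine ⟨hb, ⟨?_, ?_, ?_, ?_, ?_, ?_⟩, by omega⟩
  · intro i hi
    have h4 : i ≠ 4 := by omega
    have h5 : i ≠ 5 := by omega
    have h6 : i ≠ 6 := by omega
    simp [h4, h5, h6, h.nat_eq i hi]
  · simp [h.counter]
  · intro v
    simp only [NatExpr.eval, NatExpr.eval_smul, Memory.writeReal_nat,
      Memory.writeNat_same, Memory.writeNat_of_ne, ne_eq, Nat.reduceEqDiff,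
      not_false_eq_true, h.counter, h1, h2]
    -- The second half of the edge is entered into the table already modified by the first half; a ≠
    -- c keeps the two rows apart.
    have key := nbrs_update (adj := Function.update (m.nat 5) (Δ * a + m.nat 4 a) c)
      (deg := Function.update (m.nat 4) a (m.nat 4 a + 1)) (u := c) a v (Δ := Δ)
      (by rw [Function.update_of_ne hac.symm]; exact hlt c (.inr rfl))
      (by
        by_cases hv : v = a
        · rw [hv, Function.update_self]; exact hlt a (.inl rfl)
        · rw [Function.update_of_ne hv]; exact hle v)
    rw [key, nbrs_update c v (hlt a (.inl rfl)) (hle v), h.nbrs_eq, hstep]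
    by_cases hv : v = a
    · have : v ≠ c := hv ▸ hac
      simp [hv, hac, ← ha, ← hc]
    · by_cases hv' : v = c <;> simp [hv, hv', ← ha, ← hc, hac.symm]
  · intro i hi
    have h4 : i ≠ 1 := by omega
    have h5 : i ≠ 2 := by omega
    simp [h4, h5, h.real_eq i hi]
  · intro v
    have hf := h.field
    simp only [NatExpr.eval, RealExpr.eval, NatExpr.eval_smul, Memory.writeNat_real,
      Memory.writeReal_nat, Memory.writeReal_same, Memory.writeReal_of_ne,
      Memory.writeNat_same, Memory.writeNat_of_ne, ne_eq, Nat.reduceEqDiff,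
      not_false_eq_true, h.counter, h1, h2, hγ, zero_ne_one,
      OfNat.one_ne_ofNat, OfNat.ofNat_ne_one]
    by_cases hv : v = a
    · subst hv
      simp [hac, hf, pow_succ, div_div]
    · by_cases hv' : v = c
      · subst hv'
        simp [hac.symm, hf, pow_succ, div_div]
      · simp [hv, hv', hf]
  · simp [h.out, hγ, pow_succ]

/-- The memory after the initialisation. -/
structure Ready {n : ℕ} (Δ : ℕ) (G : SimpleGraph (Fin n)) (β γ ε : ℝ) (π : Fin n → ℝ)
    (m : Memory) : Prop where
  size : m.nat 0 0 = n
  alive : m.nat 3 = 0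
  table : IsAdjTable Δ (G.map Fin.val) (m.nat 4) (m.nat 5)
  counter : m.nat 6 0 = 0
  level : m.nat 7 0 = 0
  eps : m.real 0 2 = ε
  field : ∀ v : Fin n, m.real 1 v = π v / γ ^ m.nat 4 v
  out : m.real 2 0 = γ ^ G.edgeSet.ncard
  interaction : m.real 5 0 = β * γ
  interaction_pow : m.real 6 0 = (β * γ) ^ Δ
  realSize : m.real 7 0 = n
  copy : ∀ v < n, m.real 10 v = m.real 1 v

theorem natGraph_adj {n : ℕ} (G : SimpleGraph (Fin n)) (u v : Fin n) :
    (G.map Fin.val).Adj u v ↔ G.Adj u v :=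
  SimpleGraph.map_adj_apply (f := Fin.valEmbedding)

theorem natGraph_lt {n : ℕ} {G : SimpleGraph (Fin n)} {u v : ℕ} (h : (G.map Fin.val).Adj u v) :
    u < n ∧ v < n := by
  obtain ⟨-, a, c, -, rfl, rfl⟩ := h
  exact ⟨a.2, c.2⟩

section Input

variable {n : ℕ} {G : SimpleGraph (Fin n)} {E : List (Fin n × Fin n)}

theorem IsEdgeList.ncard_edgeSet (hE : IsEdgeList G E) : G.edgeSet.ncard = E.length := by
  classical
  have h : G.edgeSet = ((E.map fun e => s(e.1, e.2)).toFinset : Set (Sym2 (Fin n))) := by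
    ext e
    induction e using Sym2.ind with | _ u w =>
    rw [SimpleGraph.mem_edgeSet, hE.2]
    simp
  rw [h, Set.ncard_coe_finset, List.toFinset_card_of_nodup hE.1, List.length_map]

theorem IsEdgeList.length_le [DecidableRel G.Adj] (hE : IsEdgeList G E) {Δ : ℕ}
    (hΔ : G.maxDegree ≤ Δ) : E.length ≤ Δ * n := by
  have h1 := G.sum_degrees_eq_twice_card_edges
  have h2 : ∑ v, G.degree v ≤ ∑ _v : Fin n, Δ :=
    Finset.sum_le_sum fun v _ => (G.degree_le_maxDegree v).trans hΔ
  rw [← hE.ncard_edgeSet, ← SimpleGraph.coe_edgeFinset, Set.ncard_coe_finset]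
  simp at h2
  nlinarith

/-- The edges as pairs of natural numbers. -/
def natEdges (E : List (Fin n × Fin n)) : List (ℕ × ℕ) :=
  E.map fun e => ((e.1 : ℕ), (e.2 : ℕ))

theorem map_natEdges (E : List (Fin n × Fin n)) :
    (natEdges E).map (fun e => s(e.1, e.2)) = (E.map fun e => s(e.1, e.2)).map (Sym2.map Fin.val) := by
  simp [natEdges, Function.comp_def]

theorem IsEdgeList.nodup_natEdges (hE : IsEdgeList G E) :
    ((natEdges E).map fun e => s(e.1, e.2)).Nodup := by
  rw [map_natEdges]
  exact hE.1.map (Sym2.map.injective Fin.val_injective)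

theorem IsEdgeList.mem_incident_iff (hE : IsEdgeList G E) (v u : ℕ) :
    u ∈ incident (natEdges E) v ↔ (G.map Fin.val).Adj v u := by
  rw [mem_incident, map_natEdges, List.mem_map]
  constructor
  · rintro ⟨e, he, h⟩
    induction e using Sym2.ind with | _ x y =>
    have hxy := (natGraph_adj G x y).2 ((hE.2 x y).2 he)
    rw [Sym2.map_mk] at h
    rcases Sym2.eq_iff.1 h with ⟨rfl, rfl⟩ | ⟨rfl, rfl⟩
    · exact hxy
    · exact hxy.symm
  · intro h
    obtain ⟨hv, hu⟩ := natGraph_lt h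
    exact ⟨s(⟨v, hv⟩, ⟨u, hu⟩), (hE.2 _ _).1 ((natGraph_adj G ⟨v, hv⟩ ⟨u, hu⟩).1 h), by simp⟩

theorem ncard_neighborSet_eq {l : List ℕ} (hl : l.Nodup) (v : Fin n)
    (h : ∀ u, u ∈ l ↔ (G.map Fin.val).Adj v u) : (G.neighborSet v).ncard = l.length := by
  rw [← List.toFinset_card_of_nodup hl, ← Set.ncard_coe_finset,
    ← Set.ncard_image_of_injective _ Fin.val_injective]
  congr 1
  ext u
  simp only [Set.mem_image, SimpleGraph.mem_neighborSet, List.coe_toFinset, Set.mem_ofPred_eq, h]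
  constructor
  · rintro ⟨w, hw, rfl⟩
    exact (natGraph_adj G v w).2 hw
  · intro hu
    obtain ⟨-, hu'⟩ := natGraph_lt hu
    exact ⟨⟨u, hu'⟩, (natGraph_adj G v ⟨u, hu'⟩).1 hu, rfl⟩

theorem IsEdgeList.length_incident_le [DecidableRel G.Adj] (hE : IsEdgeList G E) {Δ : ℕ}
    (hΔ : G.maxDegree ≤ Δ) (v : ℕ) : (incident (natEdges E) v).length ≤ Δ := by
  by_cases hv : v < n
  · rw [← ncard_neighborSet_eq (nodup_incident hE.nodup_natEdges v) ⟨v, hv⟩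
      (hE.mem_incident_iff v), ← SimpleGraph.coe_neighborFinset, Set.ncard_coe_finset,
      SimpleGraph.card_neighborFinset_eq_degree]
    exact (G.degree_le_maxDegree _).trans hΔ
  · have : incident (natEdges E) v = [] := by
      refine List.eq_nil_iff_forall_not_mem.2 fun u hu => hv ?_
      exact (natGraph_lt ((hE.mem_incident_iff v u).1 hu)).1
    simp [this]

theorem setup_spec [DecidableRel G.Adj] (hE : IsEdgeList G E) {Δ : ℕ} (hΔ : G.maxDegree ≤ Δ)
    {β γ ε : ℝ} {π : Fin n → ℝ} {p : Cmd} (t : ℕ) :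
    WP p (setup Δ) (fun m t' => Ready Δ G β γ ε π m ∧ t' ≤ t + 20 * Δ * n + 20 * n + 20)
      (inputMemory β γ ε π E) t := by
  have hlen := hE.length_le hΔ
  have hlen' : (natEdges E).length = E.length := by simp [natEdges]
  unfold setup
  repeat' first | apply WP.seq | apply WP.setNat | apply WP.setReal
  refine readEdges_spec (E := natEdges E) (by simp [inputMemory, natEdges]) ?_ ?_ ?_
    (hE.length_incident_le hΔ) ⟨?_, ?_, ?_, ?_, ?_, ?_⟩ ?_
  · intro k h
    rw [hlen'] at h
    simp [inputMemory, natEdges, h]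
  · intro k h
    rw [hlen'] at h
    simp [inputMemory, natEdges, h]
  · intro e he h
    obtain ⟨x, hx, rfl⟩ := List.mem_map.1 he
    refine G.ne_of_adj ((hE.2 x.1 x.2).2 (List.mem_map.2 ⟨x, hx, rfl⟩)) (Fin.val_injective h)
  · simp
  · simp [inputMemory]
  · intro v; simp [nbrs, inputMemory, incident]
  · simp
  · intro v; simp [inputMemory]
  · simp [inputMemory]
  intro m t₁ h ht
  repeat' first | apply WP.seq | apply WP.setNat | apply WP.setReal
  have hn : ∀ a, a < 4 ∨ 6 < a → m.nat a = (inputMemory β γ ε π E).nat a := fun a ha => by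
    rw [h.nat_eq a ha]; rfl
  have hr : ∀ a, a < 1 ∨ 6 < a → m.real a = (inputMemory β γ ε π E).real a := fun a ha => by
    rw [h.real_eq a (by omega)]
    have h2 : a ≠ 2 := by omega
    have h5 : a ≠ 5 := by omega
    have h6 : a ≠ 6 := by omega
    simp [h2, h5, h6]
  have hr5 : m.real 5 0 = β * γ := by
    rw [h.real_eq 5 (by simp)]
    simp [inputMemory]
  have hr6 : m.real 6 0 = (β * γ) ^ Δ := by
    rw [h.real_eq 6 (by simp)]
    simp [inputMemory]
  refine .loop (fun k m' t' => k ≤ n ∧ m'.nat 6 0 = k ∧ (∀ a, a ≠ 6 → m'.nat a = m.nat a) ∧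
    (∀ a, a < 7 → m'.real a = m.real a) ∧ m'.real 7 0 = k ∧
    (∀ v < k, m'.real 10 v = m.real 1 v) ∧ t' ≤ t + 16 * (Δ * n) + 15 + 6 * k) n ?_ ?_
  · refine ⟨by simp, by simp, fun a ha => by simp [ha], fun a ha => by simp, ?_, by simp, ?_⟩
    · simp [hr, inputMemory]
    · rw [hlen'] at ht
      omega
  rintro k m' t' ⟨hk, h1, h2, h3, h4, h5, h6⟩
  have h7 : m'.nat 0 0 = n := by rw [h2 0 (by simp), hn 0 (by simp)]; simp [inputMemory]
  constructor
  · intro hb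
    simp [h1, h7] at hb
    have hk : k = n := by omega
    subst hk
    apply WP.setNat
    have hdeg : ∀ v, m'.nat 4 v = (incident (natEdges E) v).length := by
      intro v
      rw [h2 4 (by simp), ← length_nbrs Δ (m.nat 4) (m.nat 5) v, h.nbrs_eq, List.take_length]
    refine ⟨⟨?_, ?_, ?_, ?_, ?_, ?_, ?_, ?_, ?_, ?_, ?_, ?_⟩, by nlinarith⟩
    · simpa using h7
    · simp only [ne_eq, Nat.reduceEqDiff, not_false_eq_true,
        Memory.writeNat_of_ne]
      rw [h2 3 (by simp), hn 3 (by simp)]; rfl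
    · have hnb : ∀ v, nbrs Δ (m.nat 4) (m.nat 5) v = incident (natEdges E) v := fun v => by
        rw [h.nbrs_eq, List.take_length]
      refine ⟨fun v => ?_, fun v => ?_, fun v u => ?_⟩
      · simp [h2, hnb]
        exact nodup_incident hE.nodup_natEdges v
      · simp [hdeg]
        exact hE.length_incident_le hΔ v
      · simp [h2, hnb]
        exact hE.mem_incident_iff v u
    · simp
    · simp [h2, hn, inputMemory]
    · simp [h3, hr, inputMemory]
    · intro v
      simp [h3, h2, h.field]
      simp [inputMemory]
    · simp [h3, h.out, hE.ncard_edgeSet, hlen']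
      simp [inputMemory]
    · simp [h3, hr5]
    · simp [h3, hr6]
    · simp [h4]
    · intro v hv
      simp [h3, h5 v hv]
  · intro hb
    simp [h1, h7] at hb
    refine ⟨hb, ?_⟩
    repeat' first | apply WP.seq | apply WP.setNat | apply WP.setReal
    refine ⟨hb, by simp [h1], fun a ha => by simp [ha, h2], ?_, by simp [h4], ?_, by omega⟩
    · intro a ha
      have h7 : a ≠ 7 := by omega
      have h10 : a ≠ 10 := by omega
      simp [h7, h10, h3 a ha]
    · intro v hv
      by_cases hvk : v = k
      · simp [h1, hvk, h3]
      · simp [h1, hvk, h5 v (by omega)]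

theorem Ready.partitionFunction_eq {Δ : ℕ} {β γ ε : ℝ} {π : Fin n → ℝ} {m : Memory}
    (h : Ready Δ G β γ ε π m) (hγ : 0 < γ) :
    partitionFunction G β γ π =
      m.real 2 0 * reducedZ (G.map Fin.val) (β * γ) (Finset.range n) (m.real 1) := by
  rw [partitionFunction_eq_reducedZ G hγ π (fun v => m.nat 4 v) fun v => ?_, h.out]
  · congr 1
    have := reducedZ_map (G := G) (b := β * γ) Fin.valEmbedding Finset.univ (m.real 1)
    rw [Fin.map_valEmbedding_univ, Nat.Iio_eq_range] at this
    refine Eq.trans ?_ this.symm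
    exact reducedZ_congr fun v _ => (h.field v).symm
  · rw [ncard_neighborSet_eq (h.table.nodup v) v (h.table.mem_iff v), length_nbrs]

end Input

end TwoSpin

/-! ### The recursive enclosure of a spin ratio and its cost. -/

namespace TwoSpin

open RealRAM

/-- The interval `[lo, hi]` contains `x` and has length at most `g` on the logarithmic scale. -/
structure Encloses (x lo hi g : ℝ) : Prop where
  pos : 0 < lo
  le : lo ≤ x
  ge : x ≤ hi
  gap : Real.log hi - Real.log lo ≤ g

theorem contraction_nonneg {b : ℝ} (hb : 1 < b) : 0 ≤ (√b - 1) / (√b + 1) := by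
  have : 1 ≤ √b := Real.one_le_sqrt.2 hb.le
  exact div_nonneg (by linarith) (by linarith)

/-- For b > 1 the influence is increasing, so endpoints are mapped to endpoints. Logarithmic lengths
add under multiplication, and the new factor has been contracted. -/
theorem Encloses.mul_influence {b x lo hi g r lo' hi' g' : ℝ} (hb : 1 < b)
    (h : Encloses x lo hi g) (h' : Encloses r lo' hi' g') :
    Encloses (x * influence b r) (lo * influence b lo') (hi * influence b hi')
      (g + (√b - 1) / (√b + 1) * g') := by
  have hb0 : 0 < b := by linarith
  have hr := h'.pos.trans_le h'.le
  have hhi' := hr.trans_le h'.ge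
  have hx := h.pos.trans_le h.le
  have hhi := hx.trans_le h.ge
  have f1 := influence_pos hb0 h'.pos
  have f2 := influence_pos hb0 hr
  have f3 := influence_pos hb0 hhi'
  refine ⟨mul_pos h.pos f1, mul_le_mul h.le (influence_mono hb h'.pos h'.le) f1.le hx.le,
    mul_le_mul h.ge (influence_mono hb hr h'.ge) f2.le hhi.le, ?_⟩
  rw [Real.log_mul hhi.ne' f3.ne', Real.log_mul h.pos.ne' f1.ne']
  have h1 := log_influence_sub_le hb h'.pos (h'.le.trans h'.ge)
  have h2 := contraction_nonneg hb
  have h3 := mul_le_mul_of_nonneg_left h'.gap h2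
  have h4 := h.gap
  linarith

/-- The vertices that have not been deleted. -/
def aliveSet (n : ℕ) (dead : ℕ → ℕ) : Finset ℕ :=
  (Finset.range n).filter fun u => dead u = 0

theorem mem_aliveSet {n u : ℕ} {dead : ℕ → ℕ} : u ∈ aliveSet n dead ↔ u < n ∧ dead u = 0 := by
  simp [aliveSet]

theorem aliveSet_update (n v : ℕ) (dead : ℕ → ℕ) :
    aliveSet n (Function.update dead v 1) = (aliveSet n dead).erase v := by
  ext u
  by_cases h : u = v <;> simp [mem_aliveSet, h]

/-- The expression `(1 + b * x) / (1 + x)`. -/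
def influenceExpr (x : RealExpr) : RealExpr :=
  .div (.add (.lit 1) (.mul (rvar 5) x)) (.add (.lit 1) x)

@[simp] theorem eval_influenceExpr (m : Memory) (x : RealExpr) :
    (influenceExpr x).eval m = influence (m.real 5 0) (x.eval m) := by
  simp [influenceExpr, influence]

/-- The root of the current call, stored on the stack. -/
abbrev rootExpr : NatExpr := .get 8 (nvar 7)

/-- The position in the adjacency list of the root, stored on the stack. -/
abbrev indexExpr : NatExpr := .get 9 (nvar 7)

/-- The current neighbour of the root. -/
abbrev neighborExpr (Δ : ℕ) : NatExpr := .get 5 (.add (.smul Δ rootExpr) indexExpr)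

/-- Calls the procedure for the current neighbour and takes its influence into account. -/
def descend (Δ : ℕ) : Cmd :=
  .seq (.setNat 8 (.add (nvar 7) (.lit 1)) (neighborExpr Δ))
    (.seq (.setNat 7 (.lit 0) (.add (nvar 7) (.lit 1)))
      (.seq .call
        (.seq (.setNat 7 (.lit 0) (.sub (nvar 7) (.lit 1)))
          (.seq (.setReal 3 (nvar 7) (.mul (.get 3 (nvar 7))
              (influenceExpr (.get 3 (.add (nvar 7) (.lit 1))))))
            (.seq (.setReal 4 (nvar 7) (.mul (.get 4 (nvar 7))
                (influenceExpr (.get 4 (.add (nvar 7) (.lit 1))))))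
              (.setReal 1 (neighborExpr Δ) (.mul (.get 1 (neighborExpr Δ)) (rvar 5))))))))

/-- Runs `c` for every remaining neighbour of the root. -/
def forNeighbors (Δ : ℕ) (c : Cmd) : Cmd :=
  .loop (.natLt indexExpr (.get 4 rootExpr))
    (.seq (.ite (.natEq (.get 3 (neighborExpr Δ)) (.lit 0)) c .skip)
      (.setNat 9 (nvar 7) (.add indexExpr (.lit 1))))

/-- Undoes the change of the field at the current neighbour. -/
def restore (Δ : ℕ) : Cmd :=
  .setReal 1 (neighborExpr Δ) (.div (.get 1 (neighborExpr Δ)) (rvar 5))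

/-- Encloses the ratio of the spin weights at the root by exploring the graph up to the depth that
is stored in the natural number array `10`. -/
def explore (Δ : ℕ) : Cmd :=
  .seq (.setReal 3 (nvar 7) (.get 1 rootExpr))
    (.seq (.setReal 4 (nvar 7) (.get 1 rootExpr))
      (.ite (.natEq (nvar 7) (nvar 10))
        (.setReal 4 (nvar 7) (.mul (.get 4 (nvar 7)) (rvar 6)))
        (.seq (.setNat 3 rootExpr (.lit 1))
          (.seq (.setNat 9 (nvar 7) (.lit 0))
            (.seq (forNeighbors Δ (descend Δ))
              (.seq (.setNat 9 (nvar 7) (.lit 0))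
                (.seq (forNeighbors Δ (restore Δ)) (.setNat 3 rootExpr (.lit 0)))))))))

/-- The memory is prepared for a call of `explore`. -/
structure Explorable (n Δ : ℕ) (H : SimpleGraph ℕ) (b : ℝ) (m : Memory) : Prop where
  table : IsAdjTable Δ H (m.nat 4) (m.nat 5)
  interaction : m.real 5 0 = b
  interaction_pow : m.real 6 0 = b ^ Δ
  field_pos : ∀ u ∈ aliveSet n (m.nat 3), 0 < m.real 1 u
  root_mem : m.nat 8 (m.nat 7 0) ∈ aliveSet n (m.nat 3)

/-- The memory outside of the stack from level `s` on, and the root at level `s`, agree. -/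
structure SameBelow (s : ℕ) (m m' : Memory) : Prop where
  nat_eq : ∀ a, a ≠ 8 → a ≠ 9 → m'.nat a = m.nat a
  root_eq : ∀ i ≤ s, m'.nat 8 i = m.nat 8 i
  index_eq : ∀ i < s, m'.nat 9 i = m.nat 9 i
  real_eq : ∀ a, a ≠ 3 → a ≠ 4 → m'.real a = m.real a
  lo_eq : ∀ i < s, m'.real 3 i = m.real 3 i
  hi_eq : ∀ i < s, m'.real 4 i = m.real 4 i

open Classical in
/-- `explore` with remaining depth `k`, called for a root with at most `d` neighbours, takes time at
most `T` and returns an interval of logarithmic length at most `g`. -/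
def ExploreSpec (n Δ : ℕ) (H : SimpleGraph ℕ) (b : ℝ) (k d T : ℕ) (g : ℝ) : Prop :=
  ∀ m t, Explorable n Δ H b m → m.nat 7 0 + k = m.nat 10 0 →
    (nbrs Δ (m.nat 4) (m.nat 5) (m.nat 8 (m.nat 7 0))).countP
      (· ∈ aliveSet n (m.nat 3)) ≤ d →
    WP (explore Δ) (explore Δ) (fun m' t' => SameBelow (m.nat 7 0) m m' ∧
      Encloses (spinRatio H b (aliveSet n (m.nat 3)) (m.real 1) (m.nat 8 (m.nat 7 0)))
        (m'.real 3 (m.nat 7 0)) (m'.real 4 (m.nat 7 0)) g ∧ t' ≤ t + T) m t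

theorem exploreSpec_zero {n Δ : ℕ} {H : SimpleGraph ℕ} {b : ℝ} (hb : 1 < b) (d : ℕ) :
    ExploreSpec n Δ H b 0 d 6 (Δ * Real.log b) := by
  intro m t hm hk _
  have hk : m.nat 7 0 = m.nat 10 0 := by simpa using hk
  have hv := hm.root_mem
  have hpos := hm.field_pos _ hv
  unfold explore
  apply WP.seq; apply WP.setReal; apply WP.seq; apply WP.setReal
  apply WP.ite
  · intro _
    apply WP.setReal
    refine ⟨⟨?_, ?_, ?_, ?_, ?_, ?_⟩, ?_, by omega⟩
    · simp
    · simp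
    · simp
    · intro a h3 h4; simp [h3, h4]
    · intro i hi; simp [hi.ne]
    · intro i hi; simp [hi.ne]
    · obtain ⟨h1, h2⟩ := spinRatio_bounds hb hm.field_pos (hm.table.nodup _) hv
        (hm.table.mem_iff _) (by simpa using hm.table.deg_le _)
      simp only [NatExpr.eval, RealExpr.eval, Memory.writeReal_nat, Memory.writeReal_same,
        Memory.writeReal_of_ne, ne_eq, Nat.reduceEqDiff, not_false_eq_true, Function.update_self,
        hm.interaction_pow]
      refine ⟨hpos, h1, h2, ?_⟩
      rw [Real.log_mul hpos.ne' (by positivity), Real.log_pow]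
      linarith
  · intro h
    simp [hk] at h

/-- The state of `explore` inside of its loops: the call was started at level `s` in memory `m` for
the root `v`, the field is now `q`, and `j` neighbours have been processed. -/
structure InLoop (m : Memory) (s v : ℕ) (q : ℕ → ℝ) (j : ℕ) (m' : Memory) : Prop where
  nat_eq : ∀ a, a ≠ 3 → a ≠ 8 → a ≠ 9 → m'.nat a = m.nat a
  dead_eq : m'.nat 3 = Function.update (m.nat 3) v 1
  root_eq : ∀ i ≤ s, m'.nat 8 i = m.nat 8 i
  index_eq : ∀ i < s, m'.nat 9 i = m.nat 9 i
  index : m'.nat 9 s = j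
  real_eq : ∀ a, a ≠ 1 → a ≠ 3 → a ≠ 4 → m'.real a = m.real a
  field : m'.real 1 = q
  lo_eq : ∀ i < s, m'.real 3 i = m.real 3 i
  hi_eq : ∀ i < s, m'.real 4 i = m.real 4 i

open Classical in
-- The deleted parent v occupies a place in the list of u. This lowers the branching from Δ to Δ -
-- 1, and hence the contraction factor to α.
theorem countP_lt_of_dead {n Δ : ℕ} {H : SimpleGraph ℕ} {deg adj dead : ℕ → ℕ}
    (h : IsAdjTable Δ H deg adj) {u v : ℕ} (huv : H.Adj u v) (hv : v ∉ aliveSet n dead) :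
    (nbrs Δ deg adj u).countP (· ∈ aliveSet n dead) < Δ := by
  refine lt_of_lt_of_le ?_ (h.deg_le u)
  rw [← length_nbrs Δ deg adj u]
  refine lt_of_le_of_ne List.countP_le_length fun heq => hv ?_
  have := List.countP_eq_length.1 heq v ((h.mem_iff u v).2 huv)
  simpa using this

/-- Describes the restoring loop: after j neighbours only those in `l.drop j` still carry the factor
b, and without repetitions in l a single division removes it. -/
theorem boostOn_drop {b : ℝ} (hb : 0 < b) {S : Finset ℕ} {l : List ℕ} (hl : l.Nodup) {j : ℕ}
    (hj : j < l.length) (p : ℕ → ℝ) :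
    boostOn b S (l.drop (j + 1)) p = if l[j] ∈ S then
      Function.update (boostOn b S (l.drop j) p) l[j] (boostOn b S (l.drop j) p l[j] / b)
      else boostOn b S (l.drop j) p := by
  have hmem : ∀ w, w ∈ l.drop j ↔ w = l[j] ∨ w ∈ l.drop (j + 1) := fun w => by
    rw [List.drop_eq_getElem_cons hj, List.mem_cons]
  have hnot : l[j] ∉ l.drop (j + 1) := by
    have := hl.sublist (List.drop_sublist j l)
    rw [List.drop_eq_getElem_cons hj] at this
    exact (List.nodup_cons.1 this).1
  funext w
  by_cases hw : w = l[j]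
  · subst hw
    split_ifs with h <;> simp [boostOn, hnot, h, hmem, hb.ne']
  · split_ifs <;> simp only [Function.update_of_ne hw, boostOn, hmem, hw, false_or]

open Classical in
-- The neighbours are handled in the order of the telescoping product, with v deleted and the
-- earlier living neighbours already boosted. Each living neighbour costs one recursive call and
-- adds θ * g to the logarithmic length. The second loop undoes the boosts, so the caller gets its
-- field and its deletion flags back.
theorem exploreSpec_succ {n Δ : ℕ} {H : SimpleGraph ℕ} (hH : ∀ u v, H.Adj u v → u < n ∧ v < n)
    {b : ℝ} (hb : 1 < b) {k T : ℕ} {g : ℝ} (hg : 0 ≤ g)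
    (ih : ExploreSpec n Δ H b k (Δ - 1) T g) (d : ℕ) :
    ExploreSpec n Δ H b (k + 1) d (25 * Δ + 20 + d * T)
      (d * ((√b - 1) / (√b + 1) * g)) := by
  intro m t hm hk hd
  set s := m.nat 7 0 with hs
  set v := m.nat 8 s with hv
  set S := aliveSet n (m.nat 3) with hS
  set l := nbrs Δ (m.nat 4) (m.nat 5) v with hl
  set p := m.real 1 with hp
  set θ := (√b - 1) / (√b + 1) with hθ
  have hb0 : 0 < b := by linarith
  have hvS : v ∈ S := hm.root_mem
  have hpos : ∀ u ∈ S, 0 < p u := hm.field_pos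
  have hpos' : ∀ u ∈ S.erase v, 0 < p u := fun u hu => hpos u (Finset.mem_of_mem_erase hu)
  have hlnodup : l.Nodup := hm.table.nodup v
  have hllen : l.length = m.nat 4 v := length_nbrs ..
  have hlΔ : l.length ≤ Δ := hllen ▸ hm.table.deg_le v
  have hθ0 : 0 ≤ θ := contraction_nonneg hb
  have hcount : ∀ j, (l.take j).countP (· ∈ S.erase v) ≤ d := fun j =>
    ((List.take_sublist j l).countP_le.trans (List.countP_mono_left fun u _ hu => by
      simp only [decide_eq_true_eq] at hu ⊢
      exact Finset.mem_of_mem_erase hu)).trans hd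
  have hZ := reducedZ_pos (G := H) hb0 hpos'
  -- reading off the loop variables
  have hread : ∀ {j q m'}, InLoop m s v q j m' → m'.nat 7 0 = s ∧ m'.nat 8 s = v ∧
      m'.nat 4 v = l.length ∧ (∀ h : j < l.length, m'.nat 5 (Δ * v + j) = l[j] ∧
        (m'.nat 3 l[j] = 0 ↔ l[j] ∈ S.erase v)) := by
    intro j q m' h
    refine ⟨by rw [h.nat_eq 7 (by simp) (by simp) (by simp)], h.root_eq s le_rfl,
      by rw [h.nat_eq 4 (by simp) (by simp) (by simp), hllen], fun hj => ⟨?_, ?_⟩⟩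
    · rw [h.nat_eq 5 (by simp) (by simp) (by simp)]; simp [hl]
    · have hadj := (hm.table.mem_iff v _).1 (List.getElem_mem hj)
      rw [h.dead_eq, hS, ← aliveSet_update, mem_aliveSet]
      simp [(hH _ _ hadj).2]
  unfold explore
  apply WP.seq; apply WP.setReal; apply WP.seq; apply WP.setReal
  apply WP.ite
  · intro h
    simp [← hs] at h
    omega
  intro _
  apply WP.seq; apply WP.setNat; apply WP.seq; apply WP.setNat; apply WP.seq
  -- The interval at level s encloses p v times the product of the factors met so far. The number of
  -- living neighbours among the first j measures both its length and the calls made.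
  refine WP.loop (fun j m' t' => j ≤ l.length ∧
    InLoop m s v (boostOn b (S.erase v) (l.take j) p) j m' ∧
    Encloses (p v * (reducedZ H b (S.erase v) (boostOn b (S.erase v) (l.take j) p) /
      reducedZ H b (S.erase v) p)) (m'.real 3 s) (m'.real 4 s)
      ((l.take j).countP (· ∈ S.erase v) * (θ * g)) ∧
    t' ≤ t + 10 + 18 * j + (l.take j).countP (· ∈ S.erase v) * T) l.length ?_ ?_
  · refine ⟨by simp, ⟨?_, ?_, ?_, ?_, ?_, ?_, ?_, ?_, ?_⟩, ?_, ?_⟩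
    · intro a h3 h8 h9; simp [h3, h9]
    · simp [← hs, ← hv]
    · simp
    · intro i hi; simp [← hs, hi.ne]
    · simp [← hs]
    · intro a h1 h3 h4; simp [h3, h4]
    · simp [boostOn_nil, hp]
    · intro i hi; simp [← hs, hi.ne]
    · intro i hi; simp [← hs, hi.ne]
    · simp only [List.take_zero, boostOn_nil, div_self hZ.ne']
      refine ⟨?_, ?_, ?_, ?_⟩ <;> simp [← hs, ← hv, ← hp, hpos v hvS]
    · simp
  rintro j m' t' ⟨hj, hI, hE, ht⟩
  obtain ⟨r1, r2, r3, r4⟩ := hread hI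
  have hj9 := hI.index
  constructor
  · -- the end of the first loop
    intro hlt
    simp [r1, r2, r3, hj9] at hlt
    have hjl : j = l.length := by omega
    subst hjl
    rw [List.take_length] at hI hE ht
    have hcl := hcount l.length
    rw [List.take_length] at hcl
    have hE' : Encloses (spinRatio H b S p v) (m'.real 3 s) (m'.real 4 s) (d * (θ * g)) := by
      rw [spinRatio_eq_boostOn (hm.table.mem_iff v)]
      refine ⟨hE.pos, hE.le, hE.ge, hE.gap.trans ?_⟩
      have : ((l.countP (· ∈ S.erase v) : ℕ) : ℝ) ≤ d := by exact_mod_cast hcl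
      gcongr
    have ht' : t' ≤ t + 10 + 18 * l.length + d * T := ht.trans (by gcongr)
    apply WP.seq; apply WP.setNat; apply WP.seq
    refine WP.loop (fun j m₂ t₂ => j ≤ l.length ∧
      InLoop m s v (boostOn b (S.erase v) (l.drop j) p) j m₂ ∧
      m₂.real 3 s = m'.real 3 s ∧ m₂.real 4 s = m'.real 4 s ∧
      t₂ ≤ t + 15 + 18 * l.length + d * T + 5 * j) l.length ?_ ?_
    · refine ⟨by simp, ⟨?_, ?_, ?_, ?_, ?_, ?_, ?_, ?_, ?_⟩, by simp, by simp, by omega⟩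
      · intro a h3 h8 h9; simp [h9, hI.nat_eq a h3 h8 h9]
      · simp [hI.dead_eq]
      · intro i hi; simp [hI.root_eq i hi]
      · intro i hi; simp [r1, hi.ne, hI.index_eq i hi]
      · simp [r1]
      · intro a h1 h3 h4; simp [hI.real_eq a h1 h3 h4]
      · simp [hI.field]
      · intro i hi; simp [hI.lo_eq i hi]
      · intro i hi; simp [hI.hi_eq i hi]
    rintro j m₂ t₂ ⟨hj, hI₂, hlo, hhi, ht₂⟩
    obtain ⟨r1, r2, r3, r4⟩ := hread hI₂
    have hj9 := hI₂.index
    constructor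
    · intro hlt
      simp [r1, r2, r3, hj9] at hlt
      have hjl : j = l.length := by omega
      subst hjl
      rw [List.drop_length, boostOn_nil] at hI₂
      apply WP.setNat
      refine ⟨⟨?_, ?_, ?_, ?_, ?_, ?_⟩, ?_, by omega⟩
      · intro a h8 h9
        by_cases h3 : a = 3
        · subst h3
          -- The root was alive when the call began, so resetting its flag to 0 restores the old
          -- contents exactly.
          have : m.nat 3 v = 0 := (mem_aliveSet.1 hvS).2
          simp [r1, r2, hI₂.dead_eq, Function.update_eq_self_iff, this]
        · simp [h3, hI₂.nat_eq a h3 h8 h9]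
      · intro i hi; simp [hI₂.root_eq i hi]
      · intro i hi; simp [hI₂.index_eq i hi]
      · intro a h3 h4
        by_cases h1 : a = 1
        · subst h1; simp [hI₂.field, hp]
        · simp [hI₂.real_eq a h1 h3 h4]
      · intro i hi; simp [hI₂.lo_eq i hi]
      · intro i hi; simp [hI₂.hi_eq i hi]
      · simpa [hlo, hhi] using hE'
    · intro hlt
      simp [r1, r2, r3, hj9] at hlt
      obtain ⟨r5, r6⟩ := r4 hlt
      refine ⟨hlt, ?_⟩
      have hdrop := boostOn_drop hb0 (S := S.erase v) hlnodup hlt p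
      have hb5 : m₂.real 5 0 = b := by
        rw [hI₂.real_eq 5 (by simp) (by simp) (by simp), hm.interaction]
      have hf := hI₂.field
      apply WP.seq; apply WP.ite
      · intro hu
        simp [r1, r2, hj9, r5, r6] at hu
        rw [if_pos (by simpa using hu)] at hdrop
        unfold restore
        apply WP.setReal; apply WP.setNat
        refine ⟨hlt, ⟨?_, ?_, ?_, ?_, ?_, ?_, ?_, ?_, ?_⟩, ?_, ?_, by omega⟩
        · intro a h3 h8 h9; simp [h9, hI₂.nat_eq a h3 h8 h9]
        · simp [hI₂.dead_eq]
        · intro i hi; simp [hI₂.root_eq i hi]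
        · intro i hi; simp [r1, hi.ne, hI₂.index_eq i hi]
        · simp [r1, hj9]
        · intro a h1 h3 h4; simp [h1, hI₂.real_eq a h1 h3 h4]
        · simp [r1, r2, r5, hj9, hb5, hf, hdrop]
        · intro i hi; simp [hI₂.lo_eq i hi]
        · intro i hi; simp [hI₂.hi_eq i hi]
        · simp [hlo]
        · simp [hhi]
      · intro hu
        simp only [Test.Holds, NatExpr.eval, NatExpr.eval_smul, r1, r2, hj9, r5, r6] at hu
        rw [if_neg hu] at hdrop
        apply WP.skip; apply WP.setNat
        refine ⟨hlt, ⟨?_, ?_, ?_, ?_, ?_, ?_, ?_, ?_, ?_⟩, ?_, ?_, by omega⟩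
        · intro a h3 h8 h9; simp [h9, hI₂.nat_eq a h3 h8 h9]
        · simp [hI₂.dead_eq]
        · intro i hi; simp [hI₂.root_eq i hi]
        · intro i hi; simp [r1, hi.ne, hI₂.index_eq i hi]
        · simp [r1, hj9]
        · intro a h1 h3 h4; simp [hI₂.real_eq a h1 h3 h4]
        · simp [hf, hdrop]
        · intro i hi; simp [hI₂.lo_eq i hi]
        · intro i hi; simp [hI₂.hi_eq i hi]
        · simp [hlo]
        · simp [hhi]
  · -- a round of the first loop
    intro hlt
    simp [r1, r2, r3, hj9] at hlt
    obtain ⟨r5, r6⟩ := r4 hlt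
    refine ⟨hlt, ?_⟩
    set u := l[j] with hu'
    have htake : l.take (j + 1) = l.take j ++ [u] := (List.take_concat_get' l j hlt).symm
    have hnot : u ∉ l.take j := by
      have := hlnodup.sublist (List.take_sublist (j + 1) l)
      rw [htake] at this
      intro h
      exact (List.nodup_append.1 this).2.2 u h u (by simp) rfl
    have hf := hI.field
    apply WP.seq; apply WP.ite
    · intro hu
      simp only [Test.Holds, NatExpr.eval, NatExpr.eval_smul, r1, r2, hj9, r5, r6] at hu
      have hb5 : m'.real 5 0 = b := by
        rw [hI.real_eq 5 (by simp) (by simp) (by simp), hm.interaction]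
      have hposj := boostOn_pos (T := S.erase v) hb0 hpos' (l.take j)
      have hadj : H.Adj v u := (hm.table.mem_iff v u).1 (List.getElem_mem hlt)
      have halive : aliveSet n (m'.nat 3) = S.erase v := by rw [hI.dead_eq, aliveSet_update]
      have hdeg : m'.nat 4 = m.nat 4 := hI.nat_eq 4 (by simp) (by simp) (by simp)
      have htab : m'.nat 5 = m.nat 5 := hI.nat_eq 5 (by simp) (by simp) (by simp)
      unfold descend
      apply WP.seq; apply WP.setNat; apply WP.seq; apply WP.setNat; apply WP.seq; apply WP.call
      refine (ih _ _ ⟨?_, ?_, ?_, ?_, ?_⟩ ?_ ?_).mono ?_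
      · simpa [hdeg, htab] using hm.table
      · simpa using hb5
      · simp [hI.real_eq 6, hm.interaction_pow]
      · simpa [halive, hf] using fun u h1 h2 => hposj u (Finset.mem_erase.2 ⟨h1, h2⟩)
      · simpa [halive, r1, r2, hj9, r5] using hu
      · simp [r1, hI.nat_eq 10]
        omega
      · have h1 := countP_lt_of_dead (n := n) (dead := m'.nat 3) hm.table hadj.symm
          (by rw [halive]; simp)
        rw [halive] at h1
        simp [halive, r1, r2, hj9, r5, hdeg, htab]
        simp at h1
        omega
      · rintro m₁ t₁ ⟨hsame, henc, ht₁⟩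
        simp [halive, r1, r2, hj9, r5, hf] at hsame henc ht₁
        have n7 : m₁.nat 7 0 = s + 1 := by simp [hsame.nat_eq 7]
        have n8 : ∀ i ≤ s, m₁.nat 8 i = m.nat 8 i := fun i hi => by
          rw [hsame.root_eq i (by omega)]
          simp [show i ≠ s + 1 by omega, hI.root_eq i hi]
        have n8s : m₁.nat 8 s = v := n8 s le_rfl
        have n9 : ∀ i ≤ s, m₁.nat 9 i = m'.nat 9 i := fun i hi => by
          rw [hsame.index_eq i (by omega)]
          simp
        have n9s : m₁.nat 9 s = j := by rw [n9 s le_rfl, hj9]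
        have n5 : m₁.nat 5 (Δ * v + j) = u := by simp [hsame.nat_eq 5, r5]
        have nn : ∀ a, a ≠ 3 → a ≠ 7 → a ≠ 8 → a ≠ 9 → m₁.nat a = m.nat a :=
          fun a h3 h7 h8 h9 => by
            rw [hsame.nat_eq a h8 h9]
            simp [h7, h8, hI.nat_eq a h3 h8 h9]
        have l3 : ∀ i ≤ s, m₁.real 3 i = m'.real 3 i := fun i hi => by
          rw [hsame.lo_eq i (by omega)]
          simp
        have l4 : ∀ i ≤ s, m₁.real 4 i = m'.real 4 i := fun i hi => by
          rw [hsame.hi_eq i (by omega)]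
          simp
        have rr : ∀ a, a ≠ 3 → a ≠ 4 → m₁.real a = m'.real a := fun a h3 h4 => by
          rw [hsame.real_eq a h3 h4]
          simp
        have hb5' : m₁.real 5 0 = b := by rw [rr 5 (by simp) (by simp), hb5]
        have hcnt : (l.take (j + 1)).countP (· ∈ S.erase v) =
            (l.take j).countP (· ∈ S.erase v) + 1 := by
          rw [htake, List.countP_append]
          simp [List.countP_cons]
          simpa using hu
        repeat' first | apply WP.seq | apply WP.setNat | apply WP.setReal
        refine ⟨hlt, ⟨?_, ?_, ?_, ?_, ?_, ?_, ?_, ?_, ?_⟩, ?_, ?_⟩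
        · intro a h3 h8 h9
          by_cases h7 : a = 7
          · subst h7
            funext i
            by_cases hi : i = 0
            · simp [hi, n7, hs]
            · simp [hi, hsame.nat_eq 7, hI.nat_eq 7]
          · simp [h9, h7, nn a h3 h7 h8 h9]
        · simp [hsame.nat_eq 3, hI.dead_eq]
        · intro i hi; simp [n8 i hi]
        · intro i hi; simp [n7, hi.ne, n9 i hi.le, hI.index_eq i hi]
        · simp [n7, n9s]
        · intro a h1 h3 h4
          simp [h1, h3, h4, rr a h3 h4, hI.real_eq a h1 h3 h4]
        · simp [n7, n8s, n9s, n5, hb5', rr 1, hf]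
          rw [htake, boostOn_concat_of_mem hu hnot]
        · intro i hi; simp [n7, hi.ne, l3 i hi.le, hI.lo_eq i hi]
        · intro i hi; simp [n7, hi.ne, l4 i hi.le, hI.hi_eq i hi]
        -- Boosting u multiplies the partial product by the influence of the ratio that the
        -- recursive call has just enclosed.
        · rw [htake, boostOn_concat_of_mem hu hnot, reducedZ_update hb0 hposj hu, ← htake, hcnt]
          have := hE.mul_influence hb henc
          simp [n7, hb5', l3 s le_rfl, l4 s le_rfl]
          convert this using 1
          · ring
          · simp; ring
        · rw [hcnt]
          simp at ht ⊢
          nlinarith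
    · intro hu
      simp only [Test.Holds, NatExpr.eval, NatExpr.eval_smul, r1, r2, hj9, r5, r6] at hu
      have hcnt : (l.take (j + 1)).countP (· ∈ S.erase v) =
          (l.take j).countP (· ∈ S.erase v) := by
        rw [htake, List.countP_append]
        simp [List.countP_cons]
        simpa using hu
      apply WP.skip; apply WP.setNat
      refine ⟨hlt, ⟨?_, ?_, ?_, ?_, ?_, ?_, ?_, ?_, ?_⟩, ?_, ?_⟩
      · intro a h3 h8 h9; simp [h9, hI.nat_eq a h3 h8 h9]
      · simp [hI.dead_eq]
      · intro i hi; simp [hI.root_eq i hi]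
      · intro i hi; simp [r1, hi.ne, hI.index_eq i hi]
      · simp [r1, hj9]
      · intro a h1 h3 h4; simp [hI.real_eq a h1 h3 h4]
      · simp [hf]
        rw [htake, boostOn_concat_of_notMem hu]
      · intro i hi; simp [hI.lo_eq i hi]
      · intro i hi; simp [hI.hi_eq i hi]
      · rw [htake, boostOn_concat_of_notMem hu, ← htake, hcnt]
        simpa using hE
      · rw [hcnt]; omega

end TwoSpin

/-! ### The approximation algorithm for Δ ≥ 3. -/

namespace TwoSpin

open RealRAM

theorem ExploreSpec.mono {n Δ : ℕ} {H : SimpleGraph ℕ} {b : ℝ} {k d T T' : ℕ} {g g' : ℝ}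
    (h : ExploreSpec n Δ H b k d T g) (hT : T ≤ T') (hg : g ≤ g') :
    ExploreSpec n Δ H b k d T' g' := fun m t h1 h2 h3 =>
  (h m t h1 h2 h3).mono fun _ _ ⟨h4, h5, h6⟩ =>
    ⟨h4, ⟨h5.pos, h5.le, h5.ge, h5.gap.trans hg⟩, h6.trans (by omega)⟩

section Explore

variable {n Δ : ℕ} {H : SimpleGraph ℕ} {b : ℝ}

/-- With c = 25Δ + 20 the cost satisfies T' = c + (Δ - 1) T. Bounding T + c instead of T makes the
induction close, because 2c ≤ (Δ - 1) c for Δ ≥ 3. The lengths simply gain a factor α per level. -/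
theorem exploreSpec_branch (hΔ : 3 ≤ Δ) (hH : ∀ u v, H.Adj u v → u < n ∧ v < n) (hb : 1 < b)
    (k : ℕ) : ∃ T, T + (25 * Δ + 20) ≤ 2 * (25 * Δ + 20) * (Δ - 1) ^ k ∧
      ExploreSpec n Δ H b k (Δ - 1) T
        (Δ * Real.log b * (((Δ : ℝ) - 1) * ((√b - 1) / (√b + 1))) ^ k) := by
  have hθ := contraction_nonneg hb
  have hlog := Real.log_nonneg hb.le
  have hΔ' : (1 : ℝ) ≤ Δ := by exact_mod_cast (by omega : 1 ≤ Δ)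
  have hα : 0 ≤ ((Δ : ℝ) - 1) * ((√b - 1) / (√b + 1)) := mul_nonneg (by linarith) hθ
  induction k with
  | zero =>
    refine ⟨6, by simp; omega, ?_⟩
    simpa using exploreSpec_zero hb (Δ - 1)
  | succ k ih =>
    obtain ⟨T, hT, h⟩ := ih
    refine ⟨_, ?_, (exploreSpec_succ hH hb (by positivity) h (Δ - 1)).mono le_rfl (le_of_eq ?_)⟩
    · obtain ⟨q, rfl⟩ : ∃ q, Δ = q + 3 := ⟨Δ - 3, by omega⟩
      rw [show q + 3 - 1 = q + 2 by omega] at *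
      rw [pow_succ]
      nlinarith [Nat.mul_le_mul_left (q + 2) hT]
    · rw [Nat.cast_sub (by omega)]
      push_cast
      ring

/-- No neighbour of the root need be dead, so Δ replaces Δ - 1 once. As Δ ≤ 2(Δ - 1), doubling the
bounds for a branch pays for this. -/
theorem exploreSpec_root (hΔ : 3 ≤ Δ) (hH : ∀ u v, H.Adj u v → u < n ∧ v < n) (hb : 1 < b)
    (k : ℕ) : ExploreSpec n Δ H b k Δ (4 * (25 * Δ + 20) * (Δ - 1) ^ k)
        (2 * Δ * Real.log b * (((Δ : ℝ) - 1) * ((√b - 1) / (√b + 1))) ^ k) := by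
  have hθ := contraction_nonneg hb
  have hlog := Real.log_nonneg hb.le
  have hΔ' : (3 : ℝ) ≤ Δ := by exact_mod_cast hΔ
  have hα : 0 ≤ ((Δ : ℝ) - 1) * ((√b - 1) / (√b + 1)) := mul_nonneg (by linarith) hθ
  cases k with
  | zero =>
    refine (exploreSpec_zero hb Δ).mono (by simp; omega) ?_
    have : 0 ≤ (Δ : ℝ) * Real.log b := by positivity
    simp
    linarith
  | succ k =>
    obtain ⟨T, hT, h⟩ := exploreSpec_branch hΔ hH hb k
    refine (exploreSpec_succ hH hb (by positivity) h Δ).mono ?_ ?_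
    · obtain ⟨q, rfl⟩ : ∃ q, Δ = q + 3 := ⟨Δ - 3, by omega⟩
      rw [show q + 3 - 1 = q + 2 by omega] at *
      rw [pow_succ]
      have := Nat.mul_le_mul_left (q + 3) hT
      have h2 : 0 ≤ (25 * (q + 3) + 20) * (q + 2) ^ k := by positivity
      nlinarith
    · rw [pow_succ]
      have h2 : (Δ : ℝ) ≤ 2 * (Δ - 1) := by linarith
      have h3 : 0 ≤ Δ * Real.log b * ((√b - 1) / (√b + 1)) *
          (((Δ : ℝ) - 1) * ((√b - 1) / (√b + 1))) ^ k := by positivity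
      nlinarith [mul_le_mul_of_nonneg_right h2 h3]

end Explore

/-- Since hi ≤ lo * exp g and lo ≤ x ≤ M, a short logarithmic interval is also short in absolute
terms. -/
theorem Encloses.sub_le {x lo hi g M : ℝ} (h : Encloses x lo hi g) (hM : x ≤ M) :
    hi - lo ≤ M * (Real.exp g - 1) := by
  have hhi : 0 < hi := h.pos.trans_le (h.le.trans h.ge)
  have h1 : hi ≤ lo * Real.exp g := by
    rw [← Real.log_le_log_iff hhi (mul_pos h.pos (Real.exp_pos g)),
      Real.log_mul h.pos.ne' (Real.exp_pos g).ne', Real.log_exp]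
    linarith [h.gap]
  have hlogs : Real.log lo ≤ Real.log hi := Real.log_le_log h.pos (h.le.trans h.ge)
  have h2 : 0 ≤ Real.exp g - 1 := by
    rw [sub_nonneg, Real.one_le_exp_iff]
    linarith [h.gap]
  have h3 := mul_le_mul_of_nonneg_right (h.le.trans hM) h2
  linarith

/-- Increases the depth until the enclosure of the ratio at the root is sufficiently precise. -/
def deepen : Cmd :=
  .loop (.not (.realLe (.mul (.sub (rvar 4) (rvar 3)) (rvar 7)) (.get 0 (.lit 2))))
    (.seq (.setNat 10 (.lit 0) (.add (nvar 10) (.lit 1))) .call)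

/-- Takes the contribution of the next vertex into account and deletes this vertex. -/
def eliminateNext : Cmd :=
  .seq (.setNat 10 (.lit 0) (.lit 0))
    (.seq (.setNat 8 (.lit 0) (nvar 6))
      (.seq .call
        (.seq deepen
          (.seq (.setReal 2 (.lit 0) (.mul (rvar 2) (.add (.lit 1) (rvar 3))))
            (.seq (.setNat 3 (nvar 6) (.lit 1))
              (.setNat 6 (.lit 0) (.add (nvar 6) (.lit 1))))))))

/-- The approximation algorithm for maximum degree at most `Δ`. -/
def approxProgram (Δ : ℕ) : Program where
  main := .seq (setup Δ) (.loop (.natLt (nvar 6) (nvar 0)) eliminateNext)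
  proc := explore Δ

/-- The memory when `i` vertices have been eliminated. -/
structure Eliminated (n Δ : ℕ) (H : SimpleGraph ℕ) (b ε : ℝ) (p : ℕ → ℝ) (i : ℕ)
    (m : Memory) : Prop where
  size : m.nat 0 0 = n
  counter : m.nat 6 0 = i
  level : m.nat 7 0 = 0
  dead : ∀ u, m.nat 3 u = if u < i then 1 else 0
  table : IsAdjTable Δ H (m.nat 4) (m.nat 5)
  eps : m.real 0 2 = ε
  interaction : m.real 5 0 = b
  interaction_pow : m.real 6 0 = b ^ Δ
  realSize : m.real 7 0 = n
  field : m.real 1 = p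

/-- The depth L occurs only in the analysis: it is a depth at which the stopping test is certain to
succeed. The search may stop earlier, and the test itself guarantees the accuracy. -/
theorem eliminateNext_spec {n Δ : ℕ} {H : SimpleGraph ℕ} {b ε : ℝ} {p : ℕ → ℝ} {i : ℕ}
    {m : Memory} {t : ℕ} (hΔ : 3 ≤ Δ) (hH : ∀ u v, H.Adj u v → u < n ∧ v < n) (hb : 1 < b)
    (hp : ∀ u < n, 0 < p u) (hi : i < n) {M : ℝ} (hM : ∀ u < n, p u * b ^ Δ ≤ M) {L : ℕ}
    (hL : M * (Real.exp
      (2 * Δ * Real.log b * (((Δ : ℝ) - 1) * ((√b - 1) / (√b + 1))) ^ L) - 1) * n ≤ ε)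
    (hm : Eliminated n Δ H b ε p i m) :
    WP (explore Δ) eliminateNext (fun m' t' => Eliminated n Δ H b ε p (i + 1) m' ∧
      (∃ lo, 0 < lo ∧ lo ≤ spinRatio H b (aliveSet n (m.nat 3)) p i ∧
        (spinRatio H b (aliveSet n (m.nat 3)) p i - lo) * n ≤ ε ∧
        m'.real 2 0 = m.real 2 0 * (1 + lo)) ∧
      t' ≤ t + 10 + (8 * (25 * Δ + 20) + 20) * (Δ - 1) ^ L) m t := by
  set S := aliveSet n (m.nat 3) with hS
  have hSmem : ∀ u, u ∈ S ↔ u < n ∧ i ≤ u := fun u => by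
    rw [hS, mem_aliveSet, hm.dead]; by_cases h : u < i <;> simp [h]; omega
  have hpS : ∀ u ∈ S, 0 < p u := fun u hu => hp u ((hSmem u).1 hu).1
  have hiS : i ∈ S := (hSmem i).2 ⟨hi, le_rfl⟩
  have hRM : spinRatio H b S p i ≤ M :=
    (spinRatio_bounds hb hpS (hm.table.nodup i) hiS (hm.table.mem_iff i)
      (by simpa using hm.table.deg_le i)).2.trans (hM i hi)
  -- the relation between `m` and the memory while the depth is `j`
  let Rel : ℕ → Memory → Prop := fun j m' =>
    (∀ a, a ≠ 8 → a ≠ 9 → a ≠ 10 → m'.nat a = m.nat a) ∧ m'.nat 8 0 = i ∧ m'.nat 10 0 = j ∧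
    ∀ a, a ≠ 3 → a ≠ 4 → m'.real a = m.real a
  have hcall : ∀ j m' t', Rel j m' → WP (explore Δ) (explore Δ) (fun m₁ t₁ => Rel j m₁ ∧
      Encloses (spinRatio H b S p i) (m₁.real 3 0) (m₁.real 4 0)
        (2 * Δ * Real.log b * (((Δ : ℝ) - 1) * ((√b - 1) / (√b + 1))) ^ j) ∧
      t₁ ≤ t' + 4 * (25 * Δ + 20) * (Δ - 1) ^ j) m' t' := by
    rintro j m' t' ⟨h1, h2, h3, h4⟩
    have h7 : m'.nat 7 0 = 0 := by rw [h1 7 (by simp) (by simp) (by simp), hm.level]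
    have hd : m'.nat 3 = m.nat 3 := h1 3 (by simp) (by simp) (by simp)
    have hf : m'.real 1 = p := by rw [h4 1 (by simp) (by simp), hm.field]
    refine (exploreSpec_root hΔ hH hb j m' t' ⟨?_, ?_, ?_, ?_, ?_⟩ (by omega) ?_).mono ?_
    · simpa [h1] using hm.table
    · simp [h4, hm.interaction]
    · simp [h4, hm.interaction_pow]
    · rw [hd, hf]; exact hpS
    · rw [hd, h7, h2]; exact hiS
    · refine List.countP_le_length.trans ?_
      rw [length_nbrs, h1 4 (by simp) (by simp) (by simp)]
      exact hm.table.deg_le _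
    · rintro m₁ t₁ ⟨hs, he, ht⟩
      rw [h7] at hs he
      rw [hd, hf, h2] at he
      refine ⟨⟨fun a h8 h9 h10 => by rw [hs.nat_eq a h8 h9, h1 a h8 h9 h10], ?_, ?_, ?_⟩, he, ht⟩
      · rw [hs.root_eq 0 le_rfl, h2]
      · rw [hs.nat_eq 10 (by simp) (by simp), h3]
      · intro a h3' h4'; rw [hs.real_eq a h3' h4', h4 a h3' h4']
  unfold eliminateNext
  apply WP.seq; apply WP.setNat; apply WP.seq; apply WP.setNat; apply WP.seq; apply WP.call
  refine (hcall 0 _ _ ⟨?_, ?_, ?_, ?_⟩).mono ?_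
  · intro a h8 h9 h10; simp [h8, h10]
  · simp [hm.counter]
  · simp
  · simp
  rintro m₀ t₀ ⟨hR₀, hE₀, ht₀⟩
  apply WP.seq
  unfold deepen
  -- The searches of depths 0 to j together cost a constant times (Δ - 1)^j: for Δ - 1 ≥ 2 the sum
  -- is geometric.
  refine WP.loop (fun j m' t' => j ≤ L ∧ Rel j m' ∧ Encloses (spinRatio H b S p i)
    (m'.real 3 0) (m'.real 4 0)
      (2 * Δ * Real.log b * (((Δ : ℝ) - 1) * ((√b - 1) / (√b + 1))) ^ j) ∧
    t' ≤ t + (8 * (25 * Δ + 20) + 20) * (Δ - 1) ^ j) L ?_ ?_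
  · refine ⟨by simp, hR₀, hE₀, ?_⟩
    simp at ht₀ ⊢
    omega
  rintro j m' t' ⟨hjL, hR, hE, ht⟩
  have hRel := hR
  obtain ⟨h1, h2, h3, h4⟩ := hR
  have h7 : m'.real 7 0 = n := by rw [h4 7 (by simp) (by simp), hm.realSize]
  have h02 : m'.real 0 2 = ε := by rw [h4 0 (by simp) (by simp), hm.eps]
  have h6 : m'.nat 6 0 = i := by rw [h1 6 (by simp) (by simp) (by simp), hm.counter]
  constructor
  · intro hexit
    simp [h7, h02] at hexit
    repeat' first | apply WP.seq | apply WP.setNat | apply WP.setReal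
    refine ⟨⟨?_, ?_, ?_, ?_, ?_, ?_, ?_, ?_, ?_, ?_⟩, ⟨m'.real 3 0, hE.pos, hE.le, ?_, ?_⟩, ?_⟩
    · simp [h1, hm.size]
    · simp [h6]
    · simp [h1, hm.level]
    · intro u
      by_cases hu : u = i
      · simp [hu, h6]
      · simp [hu, h6, h1, hm.dead]
        congr 1
        simp; omega
    · simpa [h1] using hm.table
    · simp [h02]
    · simp [h4, hm.interaction]
    · simp [h4, hm.interaction_pow]
    · simp [h7]
    · simp [h4, hm.field]
    · refine le_trans ?_ hexit
      have := hE.ge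
      gcongr
    · simp [h4]
    · have : (Δ - 1) ^ j ≤ (Δ - 1) ^ L := Nat.pow_le_pow_right (by omega) hjL
      have := Nat.mul_le_mul_left (8 * (25 * Δ + 20) + 20) this
      omega
  · intro hgo
    simp [h7, h02] at hgo
    -- At depth L the hypothesis on L makes the interval short enough, so the loop cannot continue.
    have hjL' : j < L := by
      rcases hjL.lt_or_eq with h | h
      · exact h
      · exfalso
        subst h
        have := mul_le_mul_of_nonneg_right (hE.sub_le hRM) (Nat.cast_nonneg (α := ℝ) n)
        linarith
    refine ⟨hjL', ?_⟩
    apply WP.seq; apply WP.setNat; apply WP.call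
    refine (hcall (j + 1) _ _ ⟨?_, ?_, ?_, ?_⟩).mono ?_
    · intro a h8 h9 h10; simp [h10, h1 a h8 h9 h10]
    · simp [h2]
    · simp [h3]
    · intro a h3' h4'; simp [h4 a h3' h4']
    rintro m₁ t₁ ⟨hR₁, hE₁, ht₁⟩
    refine ⟨hjL', hR₁, hE₁, ?_⟩
    obtain ⟨q, rfl⟩ : ∃ q, Δ = q + 3 := ⟨Δ - 3, by omega⟩
    rw [show q + 3 - 1 = q + 2 by omega] at *
    rw [pow_succ] at ht₁ ⊢
    have h1 : 1 ≤ (q + 2) ^ j := Nat.one_le_pow _ _ (by omega)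
    generalize (q + 2) ^ j = x at *
    nlinarith [Nat.zero_le (q * x), Nat.zero_le (q * (q * x))]

theorem approxProgram_spec {n : ℕ} {G : SimpleGraph (Fin n)} [DecidableRel G.Adj]
    {E : List (Fin n × Fin n)} (hE : IsEdgeList G E) {Δ : ℕ} (hG : G.maxDegree ≤ Δ)
    (hΔ : 3 ≤ Δ) {β γ ε : ℝ} (hγ : 0 < γ) (hb : 1 < β * γ) {π : Fin n → ℝ}
    (hπ : ∀ v, 0 < π v) (hn : 1 ≤ n) (hε : 0 < ε) {M : ℝ}
    (hM : ∀ v, ∀ d ≤ Δ, π v / γ ^ d * (β * γ) ^ Δ ≤ M) {L : ℕ}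
    (hL : M * (Real.exp (2 * Δ * Real.log (β * γ) *
      (((Δ : ℝ) - 1) * ((√(β * γ) - 1) / (√(β * γ) + 1))) ^ L) - 1) * n ≤ ε) :
    ∃ T m, (approxProgram Δ).HaltsWithin (inputMemory β γ ε π E) T m ∧
      |output m - partitionFunction G β γ π| ≤ ε * partitionFunction G β γ π ∧
      T ≤ (300 * Δ + 300) * (n * (Δ - 1) ^ L) := by
  refine Program.HaltsWithin.of_wp (Q := fun m T =>
    |output m - partitionFunction G β γ π| ≤ ε * partitionFunction G β γ π ∧
      T ≤ (300 * Δ + 300) * (n * (Δ - 1) ^ L)) ?_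
  have hn0 : (0 : ℝ) < n := by exact_mod_cast hn
  have hb0 : 0 < β * γ := by linarith
  refine WP.seq ((setup_spec hE hG _).mono ?_)
  rintro m t ⟨hR, ht⟩
  have hH : ∀ u v, (G.map Fin.val).Adj u v → u < n ∧ v < n := fun u v h => natGraph_lt h
  have hp : ∀ u < n, 0 < m.real 1 u := fun u hu => by
    rw [hR.field ⟨u, hu⟩]
    have := hπ ⟨u, hu⟩
    positivity
  have hpM : ∀ u < n, m.real 1 u * (β * γ) ^ Δ ≤ M := fun u hu => by
    rw [hR.field ⟨u, hu⟩]
    exact hM _ _ (hR.table.deg_le u)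
  have hZ := hR.partitionFunction_eq hγ
  rw [hZ]
  set p := m.real 1 with hpdef
  set Z := m.real 2 0 * reducedZ (G.map Fin.val) (β * γ) (Finset.range n) p with hZdef
  have hpos : ∀ S : Finset ℕ, (∀ u ∈ S, u < n) →
      0 < reducedZ (G.map Fin.val) (β * γ) S p := fun S hS =>
    reducedZ_pos hb0 fun u hu => hp u (hS u hu)
  have hout : 0 < m.real 2 0 := by rw [hR.out]; positivity
  -- The output so far times the partition function of the rest is at most Z and falls short of it
  -- by at most i * ε / n * Z; the division by n has been cleared.
  refine WP.loop (fun i m' t' => i ≤ n ∧ Eliminated n Δ (G.map Fin.val) (β * γ) ε p i m' ∧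
    0 < m'.real 2 0 ∧
    m'.real 2 0 * reducedZ (G.map Fin.val) (β * γ) (aliveSet n (m'.nat 3)) p ≤ Z ∧
    Z * (n - i * ε) ≤
      n * (m'.real 2 0 * reducedZ (G.map Fin.val) (β * γ) (aliveSet n (m'.nat 3)) p) ∧
    t' ≤ t + i * (11 + (8 * (25 * Δ + 20) + 20) * (Δ - 1) ^ L)) n ?_ ?_
  · have hS : aliveSet n (m.nat 3) = Finset.range n := by
      ext u; simp [mem_aliveSet, hR.alive]
    refine ⟨by simp, ⟨hR.size, hR.counter, hR.level, ?_, hR.table, hR.eps, hR.interaction,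
      hR.interaction_pow, hR.realSize, rfl⟩, hout, ?_, ?_, by simp⟩
    · simp [hR.alive]
    · rw [hS]
    · rw [hS, ← hZdef]; simp [mul_comm]
  rintro i m' t' ⟨hi, hI, ho, h1, h2, ht'⟩
  constructor
  · intro hexit
    simp [hI.counter, hI.size] at hexit
    have hin : i = n := by omega
    subst hin
    have hS : aliveSet i (m'.nat 3) = ∅ := by
      ext u
      simp only [mem_aliveSet, hI.dead, Finset.notMem_empty, iff_false, not_and]
      intro hu; simp [hu]
    rw [hS, reducedZ_empty, mul_one] at h1 h2
    refine ⟨?_, ?_⟩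
    -- The error is one-sided, because lower endpoints have been multiplied throughout.
    · rw [output, abs_sub_comm, abs_of_nonneg (by linarith)]
      have : i * (Z - m'.real 2 0) ≤ i * (ε * Z) := by nlinarith
      exact le_of_mul_le_mul_left this hn0
    · have : 1 ≤ (Δ - 1) ^ L := Nat.one_le_pow _ _ (by omega)
      generalize (Δ - 1) ^ L = x at *
      have h3 : i ≤ i * x := Nat.le_mul_of_pos_right i this
      have h4 : Δ * i ≤ Δ * (i * x) := Nat.mul_le_mul_left _ h3
      nlinarith
  · intro hgo
    simp [hI.counter, hI.size] at hgo
    refine ⟨hgo, (eliminateNext_spec hΔ hH hb hp hgo hpM hL hI).mono ?_⟩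
    rintro m₁ t₁ ⟨hI₁, ⟨lo, hlo, hle, hgap, hm₁⟩, ht₁⟩
    have hS : aliveSet n (m₁.nat 3) = (aliveSet n (m'.nat 3)).erase i := by
      ext u
      rw [Finset.mem_erase, mem_aliveSet, mem_aliveSet, hI₁.dead, hI.dead]
      by_cases h : u < i
      · simp [h, show u < i + 1 by omega]
      · by_cases h' : u = i <;> simp [h, h']
        omega
    have hiS : i ∈ aliveSet n (m'.nat 3) := by simp [mem_aliveSet, hI.dead, hgo]
    have hpS : ∀ u ∈ aliveSet n (m'.nat 3), 0 < p u := fun u hu => hp u (mem_aliveSet.1 hu).1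
    have hmul := reducedZ_eq_mul (G := G.map Fin.val) hb0 hpS hiS
    have hZ' := hpos ((aliveSet n (m'.nat 3)).erase i) fun u hu =>
      (mem_aliveSet.1 (Finset.mem_of_mem_erase hu)).1
    rw [← hS] at hmul hZ'
    rw [hmul] at h1 h2
    set R := spinRatio (G.map Fin.val) (β * γ) (aliveSet n (m'.nat 3)) p i
    set z := reducedZ (G.map Fin.val) (β * γ) (aliveSet n (m₁.nat 3)) p
    have hoz : 0 < m'.real 2 0 * z := mul_pos ho hZ'
    refine ⟨hgo, hI₁, ?_, ?_, ?_, ?_⟩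
    · rw [hm₁]; positivity
    · rw [hm₁]; nlinarith
    · rw [hm₁]
      push_cast
      have h3 : (m'.real 2 0 * z) * ((R - lo) * n) ≤ (m'.real 2 0 * z) * ε :=
        mul_le_mul_of_nonneg_left hgap hoz.le
      -- Here 1 + R ≥ 1 enters: the current product without the new factor is still at most Z, so an
      -- additive error in R is enough.
      have h4 : (m'.real 2 0 * z) * ε ≤ Z * ε := by
        gcongr
        refine le_trans ?_ h1
        have : 0 ≤ R := hlo.le.trans hle
        nlinarith
      linarith
    · rw [add_mul, one_mul]; omega

end TwoSpin

/-! ### The exact linear-time algorithm for Δ = 2. -/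

namespace TwoSpin

open RealRAM

/-- The current neighbour of the current vertex of a path. -/
abbrev pathNeighborExpr : NatExpr := .get 5 (.add (.smul 2 (nvar 11)) (nvar 13))

/-- Passes the influence of the current vertex of a path on to its current neighbour. -/
def passInfluence : Cmd :=
  .seq (.setReal 1 pathNeighborExpr
      (.mul (.get 1 pathNeighborExpr) (influenceExpr (.get 1 (nvar 11)))))
    (.seq (.setReal 10 pathNeighborExpr
        (.mul (.get 10 pathNeighborExpr) (influenceExpr (.get 10 (nvar 11)))))
      (.setNat 12 (.lit 0) pathNeighborExpr))

/-- Passes the influence of the current vertex of a path on to its neighbours. -/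
def passInfluences : Cmd :=
  .loop (.natLt (nvar 13) (.get 4 (nvar 11)))
    (.seq (.ite (.natEq (.get 3 pathNeighborExpr) (.lit 0)) passInfluence .skip)
      (.setNat 13 (.lit 0) (.add (nvar 13) (.lit 1))))

/-- Eliminates the end of a path and moves on to its neighbour. -/
def eliminateEnd : Cmd :=
  .seq (.setNat 3 (nvar 11) (.lit 1))
    (.seq (.setReal 8 (.lit 0) (.mul (rvar 8) (.add (.lit 1) (.get 1 (nvar 11)))))
      (.seq (.setReal 9 (.lit 0) (.mul (rvar 9) (.add (.lit 1) (.get 10 (nvar 11)))))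
        (.seq (.setNat 12 (.lit 0) (nvar 11))
          (.seq (.setNat 13 (.lit 0) (.lit 0))
            (.seq passInfluences (.setNat 11 (.lit 0) (nvar 12)))))))

/-- Eliminates a path, starting from one of its ends. -/
def eliminatePath : Cmd :=
  .loop (.natEq (.get 3 (nvar 11)) (.lit 0)) eliminateEnd

/-- Eliminates the connected component of the current vertex: this vertex is deleted, and the paths
that remain are eliminated for both of its spins simultaneously. -/
def eliminateComponent : Cmd :=
  .seq (.setNat 8 (.lit 0) (nvar 6))
    (.seq (.setNat 3 (nvar 6) (.lit 1))
      (.seq (.setReal 8 (.lit 0) (.lit 1))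
        (.seq (.setReal 9 (.lit 0) (.get 1 (nvar 6)))
          (.seq (.setNat 9 (.lit 0) (.lit 0))
            (.seq (forNeighbors 2
                (.setReal 10 (neighborExpr 2) (.mul (.get 10 (neighborExpr 2)) (rvar 5))))
              (.seq (.setNat 9 (.lit 0) (.lit 0))
                (.seq (forNeighbors 2
                    (.seq (.setNat 11 (.lit 0) (neighborExpr 2)) eliminatePath))
                  (.setReal 2 (.lit 0) (.mul (rvar 2) (.add (rvar 8) (rvar 9)))))))))))

/-- The exact algorithm for maximum degree at most `2`. -/
def exactProgram : Program where
  main := .seq (setup 2) (.loop (.natLt (nvar 6) (nvar 0))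
    (.seq (.ite (.natEq (.get 3 (nvar 6)) (.lit 0)) eliminateComponent .skip)
      (.setNat 6 (.lit 0) (.add (nvar 6) (.lit 1)))))
  proc := .skip

/-- The state during the elimination of the paths of a component, relative to the memory `m₀` before
this elimination. The two fields agree outside of `pending`, and `V` is the total weight. -/
structure Peeling (n : ℕ) (H : SimpleGraph ℕ) (b : ℝ) (m₀ : Memory) (V : ℝ) (pending : List ℕ)
    (m : Memory) : Prop where
  nat_eq : ∀ a, a ≠ 3 → a ≠ 9 → a ≠ 11 → a ≠ 12 → a ≠ 13 → m.nat a = m₀.nat a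
  real_eq : ∀ a, a ≠ 1 → a ≠ 8 → a ≠ 9 → a ≠ 10 → m.real a = m₀.real a
  subset : aliveSet n (m.nat 3) ⊆ aliveSet n (m₀.nat 3)
  pos : ∀ u ∈ aliveSet n (m.nat 3), 0 < m.real 1 u
  pos' : ∀ u ∈ aliveSet n (m.nat 3), 0 < m.real 10 u
  agree : ∀ u ∈ aliveSet n (m.nat 3), u ∉ pending → m.real 1 u = m.real 10 u
  value : m.real 8 0 * reducedZ H b (aliveSet n (m.nat 3)) (m.real 1) +
    m.real 9 0 * reducedZ H b (aliveSet n (m.nat 3)) (m.real 10) = V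

/-- Of at most two neighbours of x, one is already outside S, so x is isolated or a leaf in S. -/
theorem eq_of_mem_of_dead {Δ : ℕ} {H : SimpleGraph ℕ} {deg adj : ℕ → ℕ}
    (h : IsAdjTable Δ H deg adj) (hΔ : Δ = 2) {S : Finset ℕ} {x y : ℕ} (hxy : H.Adj x y)
    (hy : y ∉ S) {u w : ℕ} (hu : H.Adj x u) (hw : H.Adj x w) (huS : u ∈ S) (hwS : w ∈ S) :
    u = w := by
  by_contra hne
  have hsub : ({y, u, w} : Finset ℕ) ⊆ (nbrs Δ deg adj x).toFinset := by
    intro z hz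
    simp only [Finset.mem_insert, Finset.mem_singleton] at hz
    rw [List.mem_toFinset, h.mem_iff]
    rcases hz with rfl | rfl | rfl <;> assumption
  have h1 := Finset.card_le_card hsub
  rw [List.toFinset_card_of_nodup (h.nodup x), length_nbrs] at h1
  have h2 := h.deg_le x
  have hyu : y ≠ u := fun e => hy (e ▸ huS)
  have hyw : y ≠ w := fun e => hy (e ▸ hwS)
  have h3 : ({y, u, w} : Finset ℕ).card = 3 := by
    rw [Finset.card_insert_of_notMem (by simp [hyu, hyw]), Finset.card_pair hne]
  omega

theorem eliminateEnd_spec {n : ℕ} {H : SimpleGraph ℕ} (hH : ∀ u v, H.Adj u v → u < n ∧ v < n)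
    {b : ℝ} (hb : 1 < b) {m₀ m : Memory} {V : ℝ} {pending : List ℕ} {t x y : ℕ} {p : Cmd}
    (htab : IsAdjTable 2 H (m₀.nat 4) (m₀.nat 5)) (hb5 : m₀.real 5 0 = b)
    (hm : Peeling n H b m₀ V (x :: pending) m) (hx : m.nat 11 0 = x)
    (hxS : x ∈ aliveSet n (m.nat 3)) (hxy : H.Adj x y) (hy : y ∉ aliveSet n (m.nat 3)) :
    WP p eliminateEnd (fun m' t' => Peeling n H b m₀ V (m'.nat 11 0 :: pending) m' ∧
      m'.nat 9 = m.nat 9 ∧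
      (aliveSet n (m'.nat 3)).card + 1 = (aliveSet n (m.nat 3)).card ∧ m'.nat 11 0 < n ∧
      (∃ y, H.Adj (m'.nat 11 0) y ∧ y ∉ aliveSet n (m'.nat 3)) ∧ t' ≤ t + 32) m t := by
  have hb0 : 0 < b := by linarith
  set S := aliveSet n (m.nat 3) with hS
  set l := nbrs 2 (m₀.nat 4) (m₀.nat 5) x with hl
  have hdeg : m.nat 4 = m₀.nat 4 := hm.nat_eq 4 (by simp) (by simp) (by simp) (by simp) (by simp)
  have hadj : m.nat 5 = m₀.nat 5 := hm.nat_eq 5 (by simp) (by simp) (by simp) (by simp) (by simp)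
  have hlen : l.length = m₀.nat 4 x := length_nbrs ..
  have hle : l.length ≤ 2 := hlen ▸ htab.deg_le x
  have hnodup : l.Nodup := htab.nodup x
  have hmem : ∀ u, u ∈ l ↔ H.Adj x u := htab.mem_iff x
  have hb5' : m.real 5 0 = b := by
    rw [hm.real_eq 5 (by simp) (by simp) (by simp) (by simp), hb5]
  have huniq : ∀ {u w}, H.Adj x u → H.Adj x w → u ∈ S → w ∈ S → u = w :=
    eq_of_mem_of_dead htab rfl hxy hy
  set f := influence b (m.real 1 x) with hf
  set f' := influence b (m.real 10 x) with hf'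
  unfold eliminateEnd
  repeat' first | apply WP.seq | apply WP.setNat | apply WP.setReal
  -- Either no living neighbour has been met, and the next vertex is still the default x, or exactly
  -- one has, and it has received the influence of x in both fields. The default x is dead and thus
  -- stops `eliminatePath`.
  refine WP.loop (fun j m' t' => j ≤ l.length ∧
    (∀ a, a ≠ 3 → a ≠ 12 → a ≠ 13 → m'.nat a = m.nat a) ∧
    m'.nat 3 = Function.update (m.nat 3) x 1 ∧ m'.nat 13 0 = j ∧
    (∀ a, a ≠ 1 → a ≠ 8 → a ≠ 9 → a ≠ 10 → m'.real a = m.real a) ∧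
    m'.real 8 0 = m.real 8 0 * (1 + m.real 1 x) ∧ m'.real 9 0 = m.real 9 0 * (1 + m.real 10 x) ∧
    (((∀ u ∈ l.take j, u ∉ S) ∧ m'.nat 12 0 = x ∧ m'.real 1 = m.real 1 ∧
      m'.real 10 = m.real 10) ∨
    (∃ w ∈ l.take j, w ∈ S ∧ m'.nat 12 0 = w ∧
      m'.real 1 = Function.update (m.real 1) w (m.real 1 w * f) ∧
      m'.real 10 = Function.update (m.real 10) w (m.real 10 w * f'))) ∧
    t' ≤ t + 11 + 9 * j) l.length ?_ ?_
  · refine ⟨by simp, ?_, ?_, ?_, ?_, ?_, ?_, .inl ⟨?_, ?_, ?_, ?_⟩, by omega⟩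
    · intro a h3 h12 h13; simp [h3, h12, h13]
    · simp [hx]
    · simp
    · intro a h1 h8 h9 h10; simp [h8, h9]
    · simp [hx]
    · simp [hx]
    · simp
    · simp [hx]
    · simp
    · simp
  rintro j m' t' ⟨hj, h1, h2, h3, h4, h5, h6, h7, ht⟩
  have h11 : m'.nat 11 0 = x := by rw [h1 11 (by simp) (by simp) (by simp), hx]
  have hd : m'.nat 4 x = l.length := by rw [h1 4 (by simp) (by simp) (by simp), hdeg, hlen]
  constructor
  · intro hexit
    simp [h3, h11, hd] at hexit
    have hjl : j = l.length := by omega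
    subst hjl
    rw [List.take_length] at h7
    apply WP.setNat
    have hS' : aliveSet n (m'.nat 3) = S.erase x := by rw [h2, aliveSet_update]
    have hcard : (S.erase x).card + 1 = S.card := Finset.card_erase_add_one hxS
    have hnat : ∀ a, a ≠ 3 → a ≠ 9 → a ≠ 11 → a ≠ 12 → a ≠ 13 →
        (m'.writeNat 11 0 (m'.nat 12 0)).nat a = m₀.nat a := fun a h3 h9 h11 h12 h13 => by
      simp [h11, h1 a h3 h12 h13, hm.nat_eq a h3 h9 h11 h12 h13]
    have hreal : ∀ a, a ≠ 1 → a ≠ 8 → a ≠ 9 → a ≠ 10 → m'.real a = m₀.real a :=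
      fun a h1 h8 h9 h10 => by rw [h4 a h1 h8 h9 h10, hm.real_eq a h1 h8 h9 h10]
    have hsub : S.erase x ⊆ aliveSet n (m₀.nat 3) := (Finset.erase_subset x S).trans hm.subset
    rcases h7 with ⟨h7, h12, hp, hp'⟩ | ⟨w, hw, hwS, h12, hp, hp'⟩
    · have hiso : ∀ w ∈ S, ¬ H.Adj x w := fun w hw h => h7 w ((hmem w).2 h) hw
      refine ⟨⟨hnat, hreal, ?_, ?_, ?_, ?_, ?_⟩, ?_, ?_, ?_, ?_, by omega⟩
      · simpa [hS'] using hsub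
      · simpa [hS', hp] using fun u _ hu => hm.pos u hu
      · simpa [hS', hp'] using fun u _ hu => hm.pos' u hu
      · simp [hS', hp, hp', h12]
        exact fun u hu huS _ hup => hm.agree u huS (by simp [hu, hup])
      · have := hm.value
        rw [reducedZ_erase_isolated hxS hiso, reducedZ_erase_isolated hxS hiso] at this
        simp [hS', hp, hp', h5, h6]
        linarith
      · simp [h1]
      · simpa [hS'] using hcard
      · simpa [h12] using (mem_aliveSet.1 hxS).1
      · refine ⟨y, by simpa [h12] using hxy, ?_⟩
        simp [hS']
        exact fun _ => hy
    · have hxw := (hmem w).1 hw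
      have hleaf : ∀ u ∈ S, H.Adj x u → u = w := fun u hu h => huniq h hxw hu hwS
      have hfpos : 0 < f := influence_pos hb0 (hm.pos x hxS)
      have hfpos' : 0 < f' := influence_pos hb0 (hm.pos' x hxS)
      refine ⟨⟨hnat, hreal, ?_, ?_, ?_, ?_, ?_⟩, ?_, ?_, ?_, ?_, by omega⟩
      · simpa [hS'] using hsub
      · simp [hS', hp]
        intro u _ hu
        by_cases huw : u = w
        · subst huw; simpa using mul_pos (hm.pos u hu) hfpos
        · simpa [huw] using hm.pos u hu
      · simp [hS', hp']
        intro u _ hu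
        by_cases huw : u = w
        · subst huw; simpa using mul_pos (hm.pos' u hu) hfpos'
        · simpa [huw] using hm.pos' u hu
      · simp [hS', hp, hp', h12]
        intro u hu huS huw hup
        simpa [huw] using hm.agree u huS (by simp [hu, hup])
      · have := hm.value
        rw [reducedZ_erase_leaf hxS hwS hxw hleaf (hm.pos x hxS),
          reducedZ_erase_leaf hxS hwS hxw hleaf (hm.pos' x hxS)] at this
        simp [hS', hp, hp', h5, h6]
        linarith
      · simp [h1]
      · simpa [hS'] using hcard
      · simpa [h12] using (mem_aliveSet.1 hwS).1
      · exact ⟨x, by simpa [h12] using hxw.symm, by simp [hS']⟩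
  · intro hgo
    simp [h3, h11, hd] at hgo
    refine ⟨hgo, ?_⟩
    set u := l[j] with hu
    have h5u : m'.nat 5 (2 * x + j) = u := by
      rw [h1 5 (by simp) (by simp) (by simp), hadj]; simp [hu, hl]
    have htake : l.take (j + 1) = l.take j ++ [u] := (List.take_concat_get' l j hgo).symm
    have hnot : u ∉ l.take j := by
      have := hnodup.sublist (List.take_sublist (j + 1) l)
      rw [htake] at this
      intro h
      exact (List.nodup_append.1 this).2.2 u h u (by simp) rfl
    have hxu : H.Adj x u := (hmem u).1 (List.getElem_mem hgo)
    have hdead : m'.nat 3 u = 0 ↔ u ∈ S := by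
      rw [h2, Function.update_of_ne hxu.ne', hS, mem_aliveSet]
      simp [(hH _ _ hxu).2]
    have hb5m : m'.real 5 0 = b := by
      rw [h4 5 (by simp) (by simp) (by simp) (by simp), hb5']
    apply WP.seq; apply WP.ite
    · intro hal
      simp [h11, h3, h5u, hdead] at hal
      rcases h7 with ⟨h7, h12, hp, hp'⟩ | ⟨w, hw, hwS, -, -, -⟩
      · unfold passInfluence
        repeat' first | apply WP.seq | apply WP.setNat | apply WP.setReal
        refine ⟨hgo, ?_, ?_, ?_, ?_, ?_, ?_, .inr ⟨u, ?_, hal, ?_, ?_, ?_⟩, by omega⟩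
        · intro a h3 h12 h13; simp [h12, h13, h1 a h3 h12 h13]
        · simp [h2]
        · simp [h3]
        · intro a h1 h8 h9 h10; simp [h1, h10, h4 a h1 h8 h9 h10]
        · simp [h5]
        · simp [h6]
        · simp [htake]
        · simp [h11, h3, h5u]
        · simp [h11, h3, h5u, hp, hb5m, hf]
        · simp [h11, h3, h5u, hp', hb5m, hf']
      · have := huniq ((hmem w).1 (List.mem_of_mem_take hw)) hxu hwS hal
        exact absurd (this ▸ hw) hnot
    · intro hal
      simp [h11, h3, h5u, hdead] at hal
      apply WP.skip; apply WP.setNat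
      refine ⟨hgo, ?_, ?_, ?_, ?_, ?_, ?_, ?_, by omega⟩
      · intro a h3 h12 h13; simp [h13, h1 a h3 h12 h13]
      · simp [h2]
      · simp [h3]
      · intro a h1 h8 h9 h10; simp [h4 a h1 h8 h9 h10]
      · simp [h5]
      · simp [h6]
      · rcases h7 with ⟨h7, h12, hp, hp'⟩ | ⟨w, hw, hwS, h12, hp, hp'⟩
        · refine .inl ⟨?_, by simp [h12], by simp [hp], by simp [hp']⟩
          intro v hv
          rw [htake, List.mem_append, List.mem_singleton] at hv
          rcases hv with hv | rfl
          · exact h7 v hv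
          · exact hal
        · exact .inr ⟨w, by rw [htake]; exact List.mem_append_left _ hw, hwS, by simp [h12],
            by simp [hp], by simp [hp']⟩

/-- The time is paid for by the deleted vertices, 40 steps each. The vertex just deleted is the dead
neighbour that makes the next vertex an end. -/
theorem eliminatePath_spec {n : ℕ} {H : SimpleGraph ℕ} (hH : ∀ u v, H.Adj u v → u < n ∧ v < n)
    {b : ℝ} (hb : 1 < b) {m₀ m : Memory} {V : ℝ} {pending : List ℕ} {t x y : ℕ} {p : Cmd}
    (htab : IsAdjTable 2 H (m₀.nat 4) (m₀.nat 5)) (hb5 : m₀.real 5 0 = b)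
    (hm : Peeling n H b m₀ V (x :: pending) m) (hx : m.nat 11 0 = x)
    (hxy : H.Adj x y) (hy : y ∉ aliveSet n (m.nat 3)) :
    WP p eliminatePath (fun m' t' => Peeling n H b m₀ V pending m' ∧ m'.nat 9 = m.nat 9 ∧
      t' + 40 * (aliveSet n (m'.nat 3)).card ≤
        t + 1 + 40 * (aliveSet n (m.nat 3)).card) m t := by
  refine WP.loop (fun j m' t' => Peeling n H b m₀ V (m'.nat 11 0 :: pending) m' ∧
    m'.nat 9 = m.nat 9 ∧ (aliveSet n (m'.nat 3)).card + j = (aliveSet n (m.nat 3)).card ∧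
    m'.nat 11 0 < n ∧ (∃ y, H.Adj (m'.nat 11 0) y ∧ y ∉ aliveSet n (m'.nat 3)) ∧
    t' ≤ t + 40 * j) (aliveSet n (m.nat 3)).card ?_ ?_
  · exact ⟨hx ▸ hm, rfl, rfl, hx ▸ (hH _ _ hxy).1, ⟨y, hx ▸ hxy, hy⟩, by simp⟩
  rintro j m' t' ⟨h1, h2, h3, h4, ⟨z, h5, h6⟩, ht⟩
  constructor
  · intro hexit
    simp at hexit
    -- The loop ends at a dead vertex, so it may be dropped from the vertices where the two fields
    -- can differ.
    refine ⟨⟨h1.nat_eq, h1.real_eq, h1.subset, h1.pos, h1.pos', ?_, h1.value⟩, h2, by omega⟩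
    intro u hu hup
    refine h1.agree u hu ?_
    rw [List.mem_cons, not_or]
    refine ⟨?_, hup⟩
    rintro rfl
    exact hexit (mem_aliveSet.1 hu).2
  · intro hgo
    simp at hgo
    have hal : m'.nat 11 0 ∈ aliveSet n (m'.nat 3) := mem_aliveSet.2 ⟨h4, hgo⟩
    have hcard := Finset.card_pos.2 ⟨_, hal⟩
    refine ⟨by omega, (eliminateEnd_spec hH hb htab hb5 h1 rfl hal h5 h6).mono ?_⟩
    rintro m₁ t₁ ⟨g1, g2, g3, g4, g5, g6⟩
    exact ⟨g1, g2.trans h2, by omega, g4, g5, by omega⟩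

/-- The state between the eliminations of components. -/
structure ComponentsEliminated (n : ℕ) (H : SimpleGraph ℕ) (b Z : ℝ) (i : ℕ) (m : Memory) :
    Prop where
  size : m.nat 0 0 = n
  counter : m.nat 6 0 = i
  level : m.nat 7 0 = 0
  dead : ∀ u ∈ aliveSet n (m.nat 3), i ≤ u
  table : IsAdjTable 2 H (m.nat 4) (m.nat 5)
  interaction : m.real 5 0 = b
  pos : ∀ u ∈ aliveSet n (m.nat 3), 0 < m.real 1 u
  copy : ∀ u ∈ aliveSet n (m.nat 3), m.real 10 u = m.real 1 u
  value : m.real 2 0 * reducedZ H b (aliveSet n (m.nat 3)) (m.real 1) = Z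

/-- Conditioning on the spin of i gives two partition functions of the same graph, with fields that
differ only at the neighbours of i. They are carried along together until the fields agree on all
living vertices; then they merge into one. -/
theorem eliminateComponent_spec {n : ℕ} {H : SimpleGraph ℕ}
    (hH : ∀ u v, H.Adj u v → u < n ∧ v < n) {b : ℝ} (hb : 1 < b) {m : Memory} {Z : ℝ}
    {t i : ℕ} {p : Cmd} (hm : ComponentsEliminated n H b Z i m)
    (hi : i ∈ aliveSet n (m.nat 3)) :
    WP p eliminateComponent (fun m' t' => ComponentsEliminated n H b Z i m' ∧
      i ∉ aliveSet n (m'.nat 3) ∧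
      t' + 40 * (aliveSet n (m'.nat 3)).card ≤ t + 60 + 40 * (aliveSet n (m.nat 3)).card)
      m t := by
  have hb0 : 0 < b := by linarith
  set S := aliveSet n (m.nat 3) with hS
  set l := nbrs 2 (m.nat 4) (m.nat 5) i with hl
  have hlen : l.length = m.nat 4 i := length_nbrs ..
  have hle : l.length ≤ 2 := hlen ▸ hm.table.deg_le i
  have hnodup : l.Nodup := hm.table.nodup i
  have hmem : ∀ u, u ∈ l ↔ H.Adj i u := hm.table.mem_iff i
  set q := m.real 10 with hq
  have hcnt := hm.counter
  have hlev := hm.level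
  have hadj : ∀ j (h : j < l.length), m.nat 5 (2 * i + j) = l[j] := fun j h => by simp [hl]
  unfold eliminateComponent
  repeat' first | apply WP.seq | apply WP.setNat | apply WP.setReal
  refine WP.loop (fun j m' t' => j ≤ l.length ∧
    (∀ a, a ≠ 3 → a ≠ 8 → a ≠ 9 → m'.nat a = m.nat a) ∧
    m'.nat 3 = Function.update (m.nat 3) i 1 ∧ m'.nat 8 0 = i ∧ m'.nat 9 0 = j ∧
    (∀ a, a ≠ 8 → a ≠ 9 → a ≠ 10 → m'.real a = m.real a) ∧
    m'.real 8 0 = 1 ∧ m'.real 9 0 = m.real 1 i ∧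
    m'.real 10 = boostOn b (S.erase i) (l.take j) q ∧ t' ≤ t + 12 + 5 * j) l.length ?_ ?_
  · refine ⟨by simp, ?_, ?_, ?_, ?_, ?_, ?_, ?_, ?_, by omega⟩
    · intro a h3 h8 h9; simp [h3, h8, h9]
    · simp [hcnt]
    · simp [hcnt]
    · simp
    · intro a h8 h9 h10; simp [h8, h9]
    · simp
    · simp [hcnt]
    · simp [boostOn_nil, hq]
  rintro j m₁ t₁ ⟨hj, a1, a2, a3, a4, a5, a6, a7, a8, ht₁⟩
  have hlev₁ : m₁.nat 7 0 = 0 := by rw [a1 7 (by simp) (by simp) (by simp), hlev]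
  have hdeg₁ : m₁.nat 4 i = l.length := by rw [a1 4 (by simp) (by simp) (by simp), hlen]
  have halive₁ : aliveSet n (m₁.nat 3) = S.erase i := by rw [a2, aliveSet_update]
  constructor
  swap
  · intro hgo
    simp [hlev₁, a3, a4, hdeg₁] at hgo
    refine ⟨hgo, ?_⟩
    set u := l[j] with hu
    have h5u : m₁.nat 5 (2 * i + j) = u := by
      rw [a1 5 (by simp) (by simp) (by simp), hadj j hgo]
    have htake : l.take (j + 1) = l.take j ++ [u] := (List.take_concat_get' l j hgo).symm
    have hnot : u ∉ l.take j := by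
      have := hnodup.sublist (List.take_sublist (j + 1) l)
      rw [htake] at this
      intro h
      exact (List.nodup_append.1 this).2.2 u h u (by simp) rfl
    have hiu : H.Adj i u := (hmem u).1 (List.getElem_mem hgo)
    have hdead : m₁.nat 3 u = 0 ↔ u ∈ S.erase i := by
      rw [← halive₁, mem_aliveSet]
      simp [(hH _ _ hiu).2]
    have hb5 : m₁.real 5 0 = b := by rw [a5 5 (by simp) (by simp) (by simp), hm.interaction]
    apply WP.seq; apply WP.ite
    · intro hal
      simp only [Test.Holds, NatExpr.eval, NatExpr.eval_smul, hlev₁, a3, a4, h5u, hdead] at hal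
      apply WP.setReal; apply WP.setNat
      refine ⟨hgo, ?_, ?_, ?_, ?_, ?_, ?_, ?_, ?_, by omega⟩
      · intro a h3 h8 h9; simp [h9, a1 a h3 h8 h9]
      · simp [a2]
      · simp [a3]
      · simp [hlev₁, a4]
      · intro a h8 h9 h10; simp [h10, a5 a h8 h9 h10]
      · simp [a6]
      · simp [a7]
      · simp [hlev₁, a3, a4, h5u, hb5, a8]
        rw [htake, boostOn_concat_of_mem hal hnot]
    · intro hal
      simp only [Test.Holds, NatExpr.eval, NatExpr.eval_smul, hlev₁, a3, a4, h5u, hdead] at hal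
      apply WP.skip; apply WP.setNat
      refine ⟨hgo, ?_, ?_, ?_, ?_, ?_, ?_, ?_, ?_, by omega⟩
      · intro a h3 h8 h9; simp [h9, a1 a h3 h8 h9]
      · simp [a2]
      · simp [a3]
      · simp [hlev₁, a4]
      · intro a h8 h9 h10; simp [a5 a h8 h9 h10]
      · simp [a6]
      · simp [a7]
      · simp [a8]
        rw [htake, boostOn_concat_of_notMem hal]
  intro hexit
  simp [hlev₁, a3, a4, hdeg₁] at hexit
  have hjl : j = l.length := by omega
  subst hjl
  rw [List.take_length] at a8
  have hpS : ∀ u ∈ S.erase i, 0 < m.real 1 u := fun u hu => hm.pos u (Finset.mem_of_mem_erase hu)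
  have hqS : ∀ u ∈ S.erase i, q u = m.real 1 u := fun u hu => hm.copy u (Finset.mem_of_mem_erase hu)
  have hreal1 : m₁.real 1 = m.real 1 := a5 1 (by simp) (by simp) (by simp)
  apply WP.seq; apply WP.setNat; apply WP.seq
  set m₀ := m₁.writeNat 9 ((NatExpr.lit 0).eval m₁) ((NatExpr.lit 0).eval m₁) with hm₀
  have hm₀nat : ∀ a, a ≠ 9 → m₀.nat a = m₁.nat a := fun a h => by simp [hm₀, h]
  have hm₀real : m₀.real = m₁.real := rfl
  have halive₀ : aliveSet n (m₀.nat 3) = S.erase i := by rw [hm₀nat 3 (by simp), halive₁]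
  have htab₀ : IsAdjTable 2 H (m₀.nat 4) (m₀.nat 5) := by
    rw [hm₀nat 4 (by simp), hm₀nat 5 (by simp), a1 4 (by simp) (by simp) (by simp),
      a1 5 (by simp) (by simp) (by simp)]
    exact hm.table
  have hb5₀ : m₀.real 5 0 = b := by
    rw [hm₀real, a5 5 (by simp) (by simp) (by simp), hm.interaction]
  set V := reducedZ H b S (m.real 1) with hV
  -- Living vertices where the fields differ can only be neighbours of i that have not been visited
  -- yet.
  refine WP.loop (fun j m' t' => j ≤ l.length ∧ Peeling n H b m₀ V (l.drop j) m' ∧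
    m'.nat 9 0 = j ∧ t' + 40 * (aliveSet n (m'.nat 3)).card ≤
      t + 26 + 40 * (S.erase i).card + 10 * j) l.length ?_ ?_
  · refine ⟨by simp, ⟨fun _ _ _ _ _ _ => rfl, fun _ _ _ _ _ => rfl, subset_rfl, ?_, ?_, ?_, ?_⟩,
      by simp [hm₀], ?_⟩
    · rw [halive₀, hm₀real, hreal1]; exact hpS
    · rw [halive₀, hm₀real, a8]
      exact boostOn_pos hb0 (fun u hu => by rw [hqS u hu]; exact hpS u hu) l
    · rw [halive₀, hm₀real, hreal1, a8]
      intro u hu hul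
      rw [List.drop_zero] at hul
      simp [boostOn, hul, hqS u hu]
    · rw [halive₀, hm₀real, hreal1, a8, a6, a7, reducedZ_boostOn hmem, hV, reducedZ_erase hi,
        one_mul]
      congr 2
      refine reducedZ_congr fun u hu => ?_
      simp only [boost, hqS u hu]
    · rw [halive₀]; omega
  rintro j m' t' ⟨hj, hP, h9, ht'⟩
  have hlev' : m'.nat 7 0 = 0 := by
    rw [hP.nat_eq 7 (by simp) (by simp) (by simp) (by simp) (by simp), hm₀nat 7 (by simp), hlev₁]
  have h8' : m'.nat 8 0 = i := by
    rw [hP.nat_eq 8 (by simp) (by simp) (by simp) (by simp) (by simp), hm₀nat 8 (by simp), a3]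
  have hdeg' : m'.nat 4 i = l.length := by
    rw [hP.nat_eq 4 (by simp) (by simp) (by simp) (by simp) (by simp), hm₀nat 4 (by simp), hdeg₁]
  have hsub := hP.subset
  rw [halive₀] at hsub
  have hcard : (S.erase i).card + 1 = S.card := Finset.card_erase_add_one hi
  constructor
  · intro hexit
    simp [hlev', h8', h9, hdeg'] at hexit
    have hjl : j = l.length := by omega
    subst hjl
    rw [List.drop_length] at hP
    have hnat : ∀ a, a ≠ 3 → a ≠ 8 → a ≠ 9 → a ≠ 11 → a ≠ 12 → a ≠ 13 → m'.nat a = m.nat a :=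
      fun a h3 h8 h9 h11 h12 h13 => by
        rw [hP.nat_eq a h3 h9 h11 h12 h13, hm₀nat a h9, a1 a h3 h8 h9]
    have hreal : ∀ a, a ≠ 1 → a ≠ 8 → a ≠ 9 → a ≠ 10 → m'.real a = m.real a :=
      fun a h1 h8 h9 h10 => by rw [hP.real_eq a h1 h8 h9 h10, hm₀real, a5 a h8 h9 h10]
    have hval := hP.value
    rw [reducedZ_congr (p := m'.real 10) (q := m'.real 1) fun u hu =>
      (hP.agree u hu (by simp)).symm] at hval
    apply WP.setReal
    refine ⟨⟨?_, ?_, ?_, ?_, ?_, ?_, ?_, ?_, ?_⟩, ?_, ?_⟩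
    · simp [hnat, hm.size]
    · simp [hnat, hcnt]
    · simp [hlev']
    · exact fun u hu => hm.dead u (Finset.mem_of_mem_erase (hsub hu))
    · simpa [hnat] using hm.table
    · simp [hreal, hm.interaction]
    · simpa using hP.pos
    · simpa using fun u hu => (hP.agree u hu (by simp)).symm
    · simp [hreal]
      rw [← hm.value, ← hS, ← hV, ← hval]
      ring
    · exact fun h => by simpa using hsub h
    · simp only [Memory.writeReal_nat]; omega
  · intro hgo
    simp [hlev', h8', h9, hdeg'] at hgo
    refine ⟨hgo, ?_⟩
    set u := l[j] with hu
    have hiu : H.Adj i u := (hmem u).1 (List.getElem_mem hgo)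
    have h5u : m'.nat 5 (2 * i + j) = u := by
      rw [hP.nat_eq 5 (by simp) (by simp) (by simp) (by simp) (by simp), hm₀nat 5 (by simp),
        a1 5 (by simp) (by simp) (by simp), hadj j hgo]
    have hdrop : l.drop j = u :: l.drop (j + 1) := List.drop_eq_getElem_cons hgo
    rw [hdrop] at hP
    apply WP.seq; apply WP.ite
    · intro _
      apply WP.seq; apply WP.setNat
      refine (eliminatePath_spec hH hb htab₀ hb5₀ (V := V) (x := u) (y := i) (pending := l.drop (j + 1))
        ⟨?_, ?_, ?_, ?_, ?_, ?_, ?_⟩ ?_ hiu.symm ?_).mono ?_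
      · intro a h3 h9 h11 h12 h13; simp [h11, hP.nat_eq a h3 h9 h11 h12 h13]
      · exact hP.real_eq
      · simpa using hP.subset
      · simpa using hP.pos
      · simpa using hP.pos'
      · simpa using hP.agree
      · simpa using hP.value
      · simp [hlev', h8', h9, h5u]
      · simp
        exact fun h => by simpa using hsub h
      · rintro m₂ t₂ ⟨hP₂, h9₂, ht₂⟩
        apply WP.setNat
        have hlev₂ : m₂.nat 7 0 = 0 := by
          rw [hP₂.nat_eq 7 (by simp) (by simp) (by simp) (by simp) (by simp), hm₀nat 7 (by simp),
            hlev₁]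
        refine ⟨hgo, ⟨?_, hP₂.real_eq, ?_, ?_, ?_, ?_, ?_⟩, ?_, ?_⟩
        · intro a h3 h9 h11 h12 h13; simp [h9, hP₂.nat_eq a h3 h9 h11 h12 h13]
        · simpa using hP₂.subset
        · simpa using hP₂.pos
        · simpa using hP₂.pos'
        · simpa using hP₂.agree
        · simpa using hP₂.value
        · simp [hlev₂, h9₂, h9]
        · simp at ht₂ ⊢; omega
    · intro hal
      simp [hlev', h8', h9, h5u] at hal
      apply WP.skip; apply WP.setNat
      refine ⟨hgo, ⟨?_, hP.real_eq, ?_, ?_, ?_, ?_, ?_⟩, ?_, ?_⟩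
      · intro a h3 h9 h11 h12 h13; simp [h9, hP.nat_eq a h3 h9 h11 h12 h13]
      · simpa using hP.subset
      · simpa using hP.pos
      · simpa using hP.pos'
      · intro w hw hwl
        -- The neighbour may have been deleted in an earlier round, for instance as the other end of
        -- a path that closes to a cycle through i. Being dead, it leaves the pending list for free.
        simp at hw
        refine hP.agree w hw ?_
        rw [List.mem_cons, not_or]
        refine ⟨?_, hwl⟩
        rintro rfl
        exact hal (mem_aliveSet.1 hw).2
      · simpa using hP.value
      · simp [hlev', h9]
      · simp; omega

theorem exactProgram_spec {n : ℕ} {G : SimpleGraph (Fin n)} [DecidableRel G.Adj]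
    {E : List (Fin n × Fin n)} (hE : IsEdgeList G E) (hG : G.maxDegree ≤ 2)
    {β γ : ℝ} (ε : ℝ) (hγ : 0 < γ) (hb : 1 < β * γ) {π : Fin n → ℝ} (hπ : ∀ v, 0 < π v)
    (hn : 1 ≤ n) :
    ∃ T m, exactProgram.HaltsWithin (inputMemory β γ ε π E) T m ∧
      output m = partitionFunction G β γ π ∧ T ≤ 300 * n := by
  refine Program.HaltsWithin.of_wp (Q := fun m T =>
    output m = partitionFunction G β γ π ∧ T ≤ 300 * n) ?_
  refine WP.seq ((setup_spec hE hG _).mono ?_)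
  rintro m t ⟨hR, ht⟩
  have hH : ∀ u v, (G.map Fin.val).Adj u v → u < n ∧ v < n := fun u v h => natGraph_lt h
  have hS : aliveSet n (m.nat 3) = Finset.range n := by
    ext u; simp [mem_aliveSet, hR.alive]
  rw [hR.partitionFunction_eq hγ]
  refine WP.loop (fun i m' t' => i ≤ n ∧ ComponentsEliminated n (G.map Fin.val) (β * γ)
    (m.real 2 0 * reducedZ (G.map Fin.val) (β * γ) (Finset.range n) (m.real 1)) i m' ∧
    t' + 40 * (aliveSet n (m'.nat 3)).card ≤ t + 40 * n + 70 * i) n ?_ ?_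
  · refine ⟨by simp, ⟨hR.size, hR.counter, hR.level, by simp, hR.table, hR.interaction, ?_, ?_,
      ?_⟩, ?_⟩
    · rw [hS]
      intro u hu
      have hu := Finset.mem_range.1 hu
      rw [hR.field ⟨u, hu⟩]
      have := hπ ⟨u, hu⟩
      positivity
    · rw [hS]
      exact fun u hu => hR.copy u (Finset.mem_range.1 hu)
    · rw [hS]
    · rw [hS]; simp
  rintro i m' t' ⟨hi, hI, ht'⟩
  constructor
  · intro hexit
    simp [hI.counter, hI.size] at hexit
    have hin : i = n := by omega
    subst hin
    have hS' : aliveSet i (m'.nat 3) = ∅ := by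
      refine Finset.eq_empty_of_forall_notMem fun u hu => ?_
      have := hI.dead u hu
      have := (mem_aliveSet.1 hu).1
      omega
    have hval := hI.value
    rw [hS', reducedZ_empty, mul_one] at hval
    exact ⟨hval, by omega⟩
  · intro hgo
    simp [hI.counter, hI.size] at hgo
    refine ⟨hgo, ?_⟩
    have hnext : ∀ m₁ : Memory, ComponentsEliminated n (G.map Fin.val) (β * γ)
        (m.real 2 0 * reducedZ (G.map Fin.val) (β * γ) (Finset.range n) (m.real 1)) i m₁ →
        i ∉ aliveSet n (m₁.nat 3) → ComponentsEliminated n (G.map Fin.val) (β * γ)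
        (m.real 2 0 * reducedZ (G.map Fin.val) (β * γ) (Finset.range n) (m.real 1)) (i + 1)
        (m₁.writeNat 6 0 (i + 1)) := by
      intro m₁ h hi
      refine ⟨by simpa using h.size, by simp, by simpa using h.level, ?_, by simpa using h.table,
        h.interaction, by simpa using h.pos, by simpa using h.copy, by simpa using h.value⟩
      intro u hu
      simp at hu
      exact Nat.lt_of_le_of_ne (h.dead u hu) fun e => hi (e ▸ hu)
    apply WP.seq; apply WP.ite
    · intro hal
      simp [hI.counter] at hal
      refine (eliminateComponent_spec hH hb hI (mem_aliveSet.2 ⟨hgo, hal⟩)).mono ?_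
      rintro m₁ t₁ ⟨hI₁, hi₁, ht₁⟩
      apply WP.setNat
      refine ⟨hgo, by simpa [hI₁.counter] using hnext m₁ hI₁ hi₁, ?_⟩
      simp
      omega
    · intro hal
      simp [hI.counter] at hal
      apply WP.skip; apply WP.setNat
      refine ⟨hgo, by
        simpa [hI.counter] using hnext m' hI fun h => hal (mem_aliveSet.1 h).2, ?_⟩
      simp
      omega

end TwoSpin

/-! ### The choice of the depth, and the main theorem. -/

namespace TwoSpin

theorem inv_criticalDegree (β γ : ℝ) :
    (√(β * γ) - 1) / (√(β * γ) + 1) = (criticalDegree β γ)⁻¹ := by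
  rw [criticalDegree, inv_div]

/-- A depth for which the error is small but the size of the search tree is bounded. -/
theorem exists_depth {α q K x e : ℝ} (hα0 : 0 < α) (hα1 : α < 1) (hq : 1 ≤ q) (hK : 1 ≤ K)
    (he : e = Real.log q / (-Real.log α)) (hx : 0 < x) :
    ∃ L : ℕ, K * x * α ^ L ≤ 1 ∧ q ^ L ≤ q * K ^ e * max 1 x ^ e := by
  have hlogα : Real.log α < 0 := Real.log_neg hα0 hα1
  have hlogq : 0 ≤ Real.log q := Real.log_nonneg hq
  have he0 : 0 ≤ e := by rw [he]; exact div_nonneg hlogq (by linarith)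
  have hex : ∃ L : ℕ, K * x * α ^ L ≤ 1 := by
    obtain ⟨L, hL⟩ := exists_pow_lt_of_lt_one (show 0 < (K * x)⁻¹ by positivity) hα1
    refine ⟨L, ?_⟩
    calc K * x * α ^ L ≤ K * x * (K * x)⁻¹ := by gcongr
      _ = 1 := mul_inv_cancel₀ (by positivity)
  classical
  -- The least L is taken because its predecessor fails, which bounds α^(-(L - 1)) by K * x.
  -- Together with q = α^(-e) this bounds q^(L - 1); the remaining q is the extra factor.
  refine ⟨Nat.find hex, Nat.find_spec hex, ?_⟩
  have hM1 : (1 : ℝ) ≤ max 1 x := le_max_left _ _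
  have hKe : 1 ≤ K ^ e := Real.one_le_rpow hK he0
  have hMe : 1 ≤ max 1 x ^ e := Real.one_le_rpow hM1 he0
  rcases h : Nat.find hex with _ | L
  · rw [pow_zero]
    exact one_le_mul_of_one_le_of_one_le (one_le_mul_of_one_le_of_one_le hq hKe) hMe
  · have hlt : 1 < K * x * α ^ L := by
      have := Nat.find_min hex (show L < Nat.find hex by omega)
      exact not_le.1 this
    have hle : (α ^ L)⁻¹ ≤ K * max 1 x := by
      rw [inv_le_iff_one_le_mul₀ (by positivity)]
      refine hlt.le.trans ?_
      have := le_max_right 1 x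
      gcongr
    have hqe : q = α⁻¹ ^ e := by
      rw [Real.rpow_def_of_pos (inv_pos.2 hα0), Real.log_inv, he,
        mul_div_cancel₀ _ (by linarith : -Real.log α ≠ 0), Real.exp_log (by linarith)]
    have hqL : q ^ L = ((α ^ L)⁻¹) ^ e := by
      rw [← inv_pow, ← Real.rpow_natCast (α⁻¹), ← Real.rpow_mul (by positivity), mul_comm,
        Real.rpow_mul (by positivity), ← hqe, Real.rpow_natCast]
    rw [pow_succ, hqL, mul_comm, mul_assoc]
    gcongr
    rw [← Real.mul_rpow (by positivity) (by positivity)]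
    exact Real.rpow_le_rpow (by positivity) hle he0

/-- Multiply 1 - g ≤ exp (-g) by exp g. This makes the final error linear in α^L. -/
theorem exp_sub_one_le {g G : ℝ} (hg : 0 ≤ g) (hG : g ≤ G) :
    Real.exp g - 1 ≤ g * Real.exp G := by
  have h1 : 1 - g ≤ Real.exp (-g) := by linarith [Real.add_one_le_exp (-g)]
  have h2 : Real.exp g * Real.exp (-g) = 1 := by rw [← Real.exp_add]; simp
  have h3 : Real.exp g ≤ Real.exp G := Real.exp_le_exp.2 hG
  have h4 := Real.exp_pos g
  nlinarith

theorem partitionFunction_nonneg {V : Type*} [Fintype V] [DecidableEq V] (G : SimpleGraph V)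
    {β γ : ℝ} (hβ : 0 ≤ β) (hγ : 0 ≤ γ) {π : V → ℝ} (hπ : ∀ v, 0 ≤ π v) :
    0 ≤ partitionFunction G β γ π :=
  Finset.sum_nonneg fun _ _ => mul_nonneg (by positivity) (Finset.prod_nonneg fun v _ => hπ v)

end TwoSpin

theorem theorem3p1 (β γ : ℝ) (hβ : 0 ≤ β) (hγ : 0 ≤ γ) (hβγ : 1 < β * γ)
    (Δ : ℕ) (hΔ : 2 ≤ Δ) (hΔc : (Δ : ℝ) < TwoSpin.criticalDegree β γ + 1) :
    ∃ (P : RealRAM.Program) (C : ℝ),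
      ∀ (n : ℕ) (G : SimpleGraph (Fin n)) [DecidableRel G.Adj] (E : List (Fin n × Fin n))
        (π : Fin n → ℝ) (lam ε : ℝ),
        G.maxDegree ≤ Δ → TwoSpin.IsEdgeList G E → (∀ v, 0 < π v) →
        IsGreatest (Set.range π) lam → 0 < ε →
        ∃ (T : ℕ) (m : RealRAM.Memory),
          P.HaltsWithin (TwoSpin.inputMemory β γ ε π E) T m ∧
          |TwoSpin.output m - TwoSpin.partitionFunction G β γ π| ≤
            ε * TwoSpin.partitionFunction G β γ π ∧
          (T : ℝ) ≤ C * (n * (max 1 (n * lam / ε)) ^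
            (Real.log ((Δ : ℝ) - 1) /
              (-Real.log (((Δ : ℝ) - 1) / TwoSpin.criticalDegree β γ)))) := by
  have hγ0 : 0 < γ := hγ.lt_of_ne (by rintro rfl; simp at hβγ; linarith)
  rcases hΔ.eq_or_lt with rfl | hΔ3
  · refine ⟨TwoSpin.exactProgram, 300, ?_⟩
    intro n G _ E π lam ε hG hE hπ hlam hε
    obtain ⟨v, -⟩ := hlam.1
    obtain ⟨T, m, h1, h2, h3⟩ := TwoSpin.exactProgram_spec hE hG ε hγ0 hβγ hπ v.pos
    refine ⟨T, m, h1, ?_, ?_⟩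
    · rw [h2, sub_self, abs_zero]
      exact mul_nonneg hε.le (TwoSpin.partitionFunction_nonneg G hβ hγ fun v => (hπ v).le)
    -- The exponent vanishes, so the bound to be met is linear in n.
    · have h : Real.log (((2 : ℕ) : ℝ) - 1) = 0 := by norm_num
      rw [h, zero_div, Real.rpow_zero, mul_one]
      exact_mod_cast h3
  set b := β * γ with hb
  set q : ℝ := (Δ : ℝ) - 1 with hq
  set α : ℝ := q / TwoSpin.criticalDegree β γ with hα
  set e : ℝ := Real.log q / (-Real.log α) with he
  have hsqrt : 1 < √b := Real.lt_sqrt_of_sq_lt (by simpa using hβγ)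
  have hc : 0 < TwoSpin.criticalDegree β γ := div_pos (by linarith) (by linarith)
  have hΔ3' : (3 : ℝ) ≤ Δ := by exact_mod_cast hΔ3
  have hq2 : 2 ≤ q := by linarith
  have hα0 : 0 < α := by positivity
  have hα1 : α < 1 := by rw [hα, div_lt_one hc]; linarith
  have hlogb : 0 < Real.log b := Real.log_pos hβγ
  set g : ℝ := 2 * Δ * Real.log b with hg
  have hg0 : 0 < g := by positivity
  -- a bound for the quotient of the normalised and the original field
  set ρ : ℝ := max 1 γ⁻¹ ^ Δ * b ^ Δ with hρ
  have hρ1 : 1 ≤ ρ := one_le_mul_of_one_le_of_one_le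
    (one_le_pow₀ (le_max_left _ _)) (one_le_pow₀ hβγ.le)
  -- The error at depth L is at most n λ ρ g exp(g) α^L, so K collects all factors that depend only
  -- on β, γ and Δ.
  set K : ℝ := max 1 (ρ * (g * Real.exp g)) with hK
  refine ⟨TwoSpin.approxProgram Δ, (300 * Δ + 300) * (q * K ^ e), ?_⟩
  intro n G _ E π lam ε hG hE hπ hlam hε
  obtain ⟨v, hv⟩ := hlam.1
  have hlam0 : 0 < lam := hv ▸ hπ v
  have hn : 1 ≤ n := v.pos
  have hn0 : (0 : ℝ) < n := by exact_mod_cast hn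
  obtain ⟨L, hL1, hL2⟩ := TwoSpin.exists_depth (q := q) (K := K) (x := n * lam / ε) (e := e)
    hα0 hα1 (by linarith) (le_max_left _ _) rfl (by positivity)
  have hM : ∀ u, ∀ d ≤ Δ, π u / γ ^ d * b ^ Δ ≤ lam * ρ := by
    intro u d hd
    rw [hρ, ← mul_assoc, div_eq_mul_inv, ← inv_pow]
    have hu : π u ≤ lam := hlam.2 ⟨u, rfl⟩
    have h4 : γ⁻¹ ^ d ≤ max 1 γ⁻¹ ^ Δ :=
      (pow_le_pow_left₀ (by positivity) (le_max_right _ _) d).trans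
        (pow_le_pow_right₀ (le_max_left _ _) hd)
    have hb0 : 0 < b := by linarith
    have := hπ u
    gcongr
  have hL : lam * ρ * (Real.exp (2 * Δ * Real.log b *
      (((Δ : ℝ) - 1) * ((√b - 1) / (√b + 1))) ^ L) - 1) * n ≤ ε := by
    have hα' : q * ((√b - 1) / (√b + 1)) = α := by
      rw [hb, TwoSpin.inv_criticalDegree, hα, div_eq_mul_inv]
    rw [hα']
    have h4 : g * α ^ L ≤ g := mul_le_of_le_one_right hg0.le (pow_le_one₀ hα0.le hα1.le)
    have h5 := TwoSpin.exp_sub_one_le (by positivity) h4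
    calc lam * ρ * (Real.exp (g * α ^ L) - 1) * n
        ≤ lam * ρ * (g * α ^ L * Real.exp g) * n := by gcongr
      _ = ρ * (g * Real.exp g) * (n * lam * α ^ L) := by ring
      _ ≤ K * (n * lam * α ^ L) := by
          gcongr
          exact le_max_right _ _
      _ = ε * (K * (n * lam / ε) * α ^ L) := by field_simp
      _ ≤ ε * 1 := by gcongr
      _ = ε := mul_one ε
  obtain ⟨T, m, h1, h2, h3⟩ := TwoSpin.approxProgram_spec hE hG hΔ3 hγ0 hβγ hπ hn hε hM hL
  refine ⟨T, m, h1, h2, ?_⟩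
  have hcast : (T : ℝ) ≤ (300 * Δ + 300) * (n * q ^ L) := by
    have : ((Δ - 1 : ℕ) : ℝ) = q := by rw [Nat.cast_sub (by omega), hq]; simp
    rw [← this]
    exact_mod_cast h3
  calc (T : ℝ) ≤ (300 * Δ + 300) * (n * q ^ L) := hcast
    _ ≤ (300 * Δ + 300) * (n * (q * K ^ e * max 1 (n * lam / ε) ^ e)) := by gcongr
    _ = _ := by ring
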